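/- **Setting.** Let $0<\beta<\alpha<1$ be parameters that may depend on $n$, and put $$\rho=\frac{(1-\alpha^2)(1-\beta^2)}{(1-\alpha\beta)^2},\qquad m=\Big\lceil n^{\frac{1-\beta^2}{(1-\alpha\beta)^2}}\Big\rceil ,\qquad \eta=\alpha\sqrt{2\log m}-\sqrt{2(1-\alpha^2)\log\log m}.$$ For a dataset $\mathcal S=\{x_1,\dots,x_n\}\subseteq\mathbb S^{d-1}\subset\mathbb R^d$, the Top-1 data structure draws $m$ independent Gaussian vectors (filters) $a_1,\dots,a_m\sim\mathcal N(0,1)^d$ and stores each $x\in\mathcal S$ in the bucket $i$ (of a hash table with $m$ buckets) that maximizes $\langle a_i,x\rangle$. A query $q\in\mathbb S^{d-1}$ inspects the buckets $i$ with $\langle a_i,q\rangle\ge\eta$, which are found by computing all $m$ inner products; it goes through their points and returns the first $x$ with $\langle q,x\rangle\ge\beta$ that it meets, or "None" if there is none. A point $x\in\mathcal S$ is close if $\langle q,x\rangle\ge\alpha$, and far if $\langle q,x\rangle<\beta$. Time is the number of steps on a unit-cost real RAM (arithmetic, elementary functions, comparisons, memory accesses and the drawing of a standard normal number cost one step each),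 and space is the number of words of the data structure. **Theorem.** Assume that, as $n\to\infty$, $\rho=O(1)$, $$\alpha-\beta=\omega\Big((1-\alpha^2)\Big(\frac{\log\log n}{\log n}\Big)^{1/2}\Big)\qquad\text{and}\qquad 1-\alpha^2=\omega\Big(\frac{\log\log m}{\log m}\Big).$$ Then the preprocessing time of Top-1 is $O(d\,n^{1+\rho/(1-\alpha^2)})$, and its space and its query time are $O(d\,n^{\rho/(1-\alpha^2)})$; these bounds hold for every outcome of the random choices, with absolute constants. Moreover, with $o(1)$ terms that depend only on $n$ and on the sequences $\alpha,\beta$ (not on $d$, $\mathcal S$, $q$), for every $d$, every dataset $\mathcal S$ of $n$ points in $\mathbb S^{d-1}$ and every query $q\in\mathbb S^{d-1}$: * Top-1 solves $(\alpha,\beta)$-ANN with probability $1-o(1)$: if $\mathcal S$ contains a close point, then with probability at least $1-o(1)$ the query returns a point $x\in\mathcal S$ with $\langle q,x\rangle\ge\beta$; * the expected number of buckets that the query inspects is at most $n^{\rho+o(1)}$; * the expected number of far points in the inspected buckets is at most $n^{\rho+o(1)}$; * each close point lies in an inspected bucket with probability at least $1-o(1)$. -/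

import Mathlib

open Filter Topology Asymptotics MeasureTheory ProbabilityTheory

/-! ## A unit-cost real RAM

A computation is a value together with the number of elementary steps spent on it. Programs are
written with the primitives of this section only. Each of them (an arithmetic operation or an
elementary function on reals, a comparison, a memory access, the drawing of one random number)
costs one step; each iteration of a loop costs one further step. -/

/-- A value together with the number of elementary steps spent to compute it. -/
structure Timed (α : Type) where
  val : α
  steps : ℕ

instance : Monad Timed where
  pure a := ⟨a, 0⟩
  bind x f := ⟨(f x.val).val, x.steps + (f x.val).steps⟩

namespace RealRAM

noncomputable section

def add (x y : ℝ) : Timed ℝ := ⟨x + y, 1⟩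

def sub (x y : ℝ) : Timed ℝ := ⟨x - y, 1⟩

def mul (x y : ℝ) : Timed ℝ := ⟨x * y, 1⟩

def div (x y : ℝ) : Timed ℝ := ⟨x / y, 1⟩

def sqrt (x : ℝ) : Timed ℝ := ⟨Real.sqrt x, 1⟩

def log (x : ℝ) : Timed ℝ := ⟨Real.log x, 1⟩

def pow (x y : ℝ) : Timed ℝ := ⟨x ^ y, 1⟩

/-- Round up to a natural number. -/
def ceil (x : ℝ) : Timed ℕ := ⟨⌈x⌉₊, 1⟩

/-- Convert a natural number to a real. -/
def toReal (n : ℕ) : Timed ℝ := ⟨(n : ℝ), 1⟩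

def le (x y : ℝ) : Timed Bool := ⟨decide (x ≤ y), 1⟩

def lt (x y : ℝ) : Timed Bool := ⟨decide (x < y), 1⟩

/-- Read a cell of an array. -/
def read {k : ℕ} {α : Type} (v : Fin k → α) (j : Fin k) : Timed α := ⟨v j, 1⟩

/-- Draw the `j`-th coordinate of the `i`-th random vector; `ω` is the source of randomness. -/
def draw (ω : ℕ × ℕ → ℝ) (i j : ℕ) : Timed ℝ := ⟨ω (i, j), 1⟩

/-- Append an entry to a list. -/
def push {α : Type} (l : List α) (a : α) : Timed (List α) := ⟨a :: l, 1⟩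

/-- One step of control flow. -/
def step : Timed Unit := ⟨(), 1⟩

/-- Fill a new array of length `k`: cell `i` is computed by `f i` and then written (one step). -/
def fill {k : ℕ} {α : Type} (f : Fin k → Timed α) : Timed (Fin k → α) :=
  ⟨fun i => (f i).val, ∑ i, ((f i).steps + 1)⟩

/-- A loop over a list with a state; each iteration costs one step besides its body. -/
def loop {ι σ : Type} (body : σ → ι → Timed σ) : List ι → σ → Timed σ
  | [], s => pure s
  | i :: l, s => ⟨(loop body l (body s i).val).val,
      1 + (body s i).steps + (loop body l (body s i).val).steps⟩

/-- A hash table with `m` empty buckets; creating it costs one step per bucket. -/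
def newTable (m n : ℕ) : Timed (Fin m → List (Fin n)) := ⟨fun _ => [], m⟩

/-- Insert the entry `k` into bucket `i` of a hash table. -/
def insert {m n : ℕ} (H : Fin m → List (Fin n)) (i : Fin m) (k : Fin n) :
    Timed (Fin m → List (Fin n)) :=
  ⟨Function.update H i (k :: H i), 1⟩

/-- The inner product of two vectors, coordinate by coordinate. -/
def dot {d : ℕ} (u v : Fin d → ℝ) : Timed ℝ :=
  loop (fun acc j => do
    let a ← read u j
    let b ← read v j
    let p ← mul a b
    add acc p) (List.finRange d) 0

end

end RealRAM

/-! ## The Top-1 data structure -/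

namespace Top1

open RealRAM

noncomputable section

/-- The unit sphere of `ℝ ^ d`. -/
abbrev UnitSphere (d : ℕ) : Type := Metric.sphere (0 : EuclideanSpace ℝ (Fin d)) 1

/-- Inner product similarity of two points of the sphere. -/
def sim {d : ℕ} (x y : UnitSphere d) : ℝ :=
  inner ℝ (x : EuclideanSpace ℝ (Fin d)) (y : EuclideanSpace ℝ (Fin d))

/-- The array of coordinates of a point of the sphere. -/
def coords {d : ℕ} (x : UnitSphere d) : Fin d → ℝ := fun j => x.1 j

/-- The number `m = ⌈n ^ ((1 - β²) / (1 - αβ)²)⌉` of Gaussian filters. -/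
def numFilters (α β : ℝ) (n : ℕ) : ℕ :=
  ⌈(n : ℝ) ^ ((1 - β ^ 2) / (1 - α * β) ^ 2)⌉₊

/-- The exponent `ρ = (1 - α²)(1 - β²) / (1 - αβ)²`. -/
def rho (α β : ℝ) : ℝ := (1 - α ^ 2) * (1 - β ^ 2) / (1 - α * β) ^ 2

/-- The data structure: `m` filters, a hash table with `m` buckets that hold (the indices of) the
stored points, the coordinates of the stored points, and the query threshold. -/
structure DataStructure (n d : ℕ) where
  m : ℕ
  filter : Fin m → Fin d → ℝ
  bucket : Fin m → List (Fin n)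
  point : Fin n → Fin d → ℝ
  threshold : ℝ

/-- Space in words: `m` filters of `d` words, `n` points of `d` words, for each bucket a header and
two words (the entry and a link) per entry, and the two numbers `m` and `threshold`. -/
def DataStructure.space {n d : ℕ} (D : DataStructure n d) : ℕ :=
  D.m * d + n * d + (∑ i, (1 + 2 * (D.bucket i).length)) + 2

/-- Compute `m`. -/
def computeNumFilters (α β : ℝ) (n : ℕ) : Timed ℕ := do
  let bb ← mul β β
  let p ← sub 1 bb
  let ab ← mul α β
  let r ← sub 1 ab
  let rr ← mul r r
  let e ← div p rr
  let N ← toReal n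
  let y ← pow N e
  ceil y

/-- Compute `η = α √(2 log m) - √(2 (1 - α²) log log m)`. -/
def computeThreshold (α : ℝ) (m : ℕ) : Timed ℝ := do
  let M ← toReal m
  let L ← log M
  let LL ← log L
  let t ← mul 2 L
  let s ← sqrt t
  let u ← mul α s
  let aa ← mul α α
  let c ← sub 1 aa
  let c2 ← mul 2 c
  let w ← mul c2 LL
  let v ← sqrt w
  sub u v

/-- An index `i` maximizing the inner product of `A i` with `x` (the first one if there are several,
`none` if there is no filter at all). -/
def argmax {m d : ℕ} (A : Fin m → Fin d → ℝ) (x : Fin d → ℝ) : Timed (Option (Fin m)) := do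
  let best ← loop (fun (b : Option (Fin m × ℝ)) i => do
    let a ← read A i
    let v ← dot a x
    match b with
    | none => pure (some (i, v))
    | some (j, w) => do
      let c ← lt w v
      if c then pure (some (i, v)) else pure (some (j, w))) (List.finRange m) none
  pure (best.map Prod.fst)

/-- The construction procedure on the dataset `S` and the source of randomness `ω`. -/
def construct {n d : ℕ} (α β : ℝ) (S : Fin n → Fin d → ℝ) (ω : ℕ × ℕ → ℝ) :
    Timed (DataStructure n d) := do
  let m ← computeNumFilters α β n
  let A ← fill (fun i : Fin m => fill (fun j : Fin d => draw ω i j))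
  let P ← fill (fun k : Fin n => fill (fun j : Fin d => read (S k) j))
  let H₀ ← newTable m n
  let H ← loop (fun H k => do
    let x ← read P k
    let best ← argmax A x
    match best with
    | none => pure H
    | some i => insert H i k) (List.finRange n) H₀
  let η ← computeThreshold α m
  pure ⟨m, A, H, P, η⟩

/-- The search procedure: the list of the buckets `i` with `⟨a_i, q⟩ ≥ η`. -/
def search {n d : ℕ} (D : DataStructure n d) (q : Fin d → ℝ) : Timed (List (Fin D.m)) :=
  loop (fun B i => do
    let a ← read D.filter i
    let v ← dot a q
    let c ← le D.threshold v
    if c then push B i else pure B) (List.finRange D.m) []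

/-- Go through the entries of one bucket until one with similarity at least `β` is met. -/
def scanBucket {n d : ℕ} (D : DataStructure n d) (β : ℝ) (q : Fin d → ℝ) :
    List (Fin n) → Timed (Option (Fin n))
  | [] => pure none
  | k :: l => do
    step
    let x ← read D.point k
    let v ← dot q x
    let c ← le β v
    if c then pure (some k) else scanBucket D β q l

/-- Go through the given buckets until a point with similarity at least `β` is met. -/
def scanBuckets {n d : ℕ} (D : DataStructure n d) (β : ℝ) (q : Fin d → ℝ) :
    List (Fin D.m) → Timed (Option (Fin n))
  | [] => pure none
  | i :: l => do
    step
    let b ← read D.bucket i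
    let r ← scanBucket D β q b
    match r with
    | some k => pure (some k)
    | none => scanBuckets D β q l

/-- The query procedure; it returns (the index of) a stored point, or `none`. -/
def query {n d : ℕ} (D : DataStructure n d) (β : ℝ) (q : Fin d → ℝ) :
    Timed (Option (Fin n)) := do
  let B ← search D q
  scanBuckets D β q B

/-- The law of the source of randomness: independent standard normal variables. -/
def gaussianSource : Measure (ℕ × ℕ → ℝ) :=
  Measure.infinitePi (fun _ : ℕ × ℕ => gaussianReal 0 1)

/-! ### The quantities in the analysis -/

/-- The construction run on a dataset in the sphere. -/
def build {n d : ℕ} (α β : ℝ) (S : Fin n → UnitSphere d) (ω : ℕ × ℕ → ℝ) :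
    Timed (DataStructure n d) :=
  construct α β (fun k => coords (S k)) ω

/-- The query `q` returns a point of the dataset with similarity at least `β` to `q`. -/
def Succeeds {n d : ℕ} (α β : ℝ) (S : Fin n → UnitSphere d) (q : UnitSphere d)
    (ω : ℕ × ℕ → ℝ) : Prop :=
  ∃ k, (query (build α β S ω).val β (coords q)).val = some k ∧ β ≤ sim q (S k)

/-- The number of buckets that the query `q` inspects. -/
def numInspected {n d : ℕ} (α β : ℝ) (S : Fin n → UnitSphere d) (q : UnitSphere d)
    (ω : ℕ × ℕ → ℝ) : ℕ :=
  (search (build α β S ω).val (coords q)).val.length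

/-- The `k`-th point is in one of the buckets that the query `q` inspects. -/
def Inspected {n d : ℕ} (α β : ℝ) (S : Fin n → UnitSphere d) (q : UnitSphere d)
    (ω : ℕ × ℕ → ℝ) (k : Fin n) : Prop :=
  ∃ i ∈ (search (build α β S ω).val (coords q)).val, k ∈ (build α β S ω).val.bucket i

/-- The number of far points (similarity to `q` less than `β`) in the inspected buckets. -/
def numFar {n d : ℕ} (α β : ℝ) (S : Fin n → UnitSphere d) (q : UnitSphere d)
    (ω : ℕ × ℕ → ℝ) : ℕ :=
  {k : Fin n | sim q (S k) < β ∧ Inspected α β S q ω k}.ncard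

end

end Top1

/-!
Let `x` and `q` be unit vectors with inner product `s`, and let `i` be the bucket of `x`.  The
score of `x` in its bucket is the maximum of `m` standard normal variables, about `√(2 log m)`,
and the score of `q` there is `s` times this maximum plus an independent centred normal variable of
variance `1 - s ^ 2`, the residual.  For `s ≥ α` the threshold `η` is `√(2 (1 - α ^ 2) log log m)`
below the expected score of `q`, which is enough to be exceeded with probability `1 - o(1)`.  For
`s < β` the residual has to be larger than `(α - β) √(2 log m) - o(√(log m))`, which has probability
at most `m ^ (-(α - β) ^ 2 / (1 - β ^ 2) + o(1)) = n ^ (ρ - 1 + o(1))`.  Summing over the points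
bounds the expected number of far points, and the expected number of inspected buckets is
`m · P(N(0, 1) ≥ η) = m ^ (1 - α ^ 2 + o(1)) = n ^ (ρ + o(1))`.

Independence is used in the following form: the residual vector is orthogonal to `x`, hence its
scores are independent of those of `x`, and in particular of the choice of the bucket.
-/

namespace Timed

@[simp] theorem val_pure {α : Type} (a : α) : (pure a : Timed α).val = a := rfl

@[simp] theorem steps_pure {α : Type} (a : α) : (pure a : Timed α).steps = 0 := rfl

@[simp] theorem val_bind {α β : Type} (x : Timed α) (f : α → Timed β) :
    (x >>= f).val = (f x.val).val := rfl

@[simp] theorem steps_bind {α β : Type} (x : Timed α) (f : α → Timed β) :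
    (x >>= f).steps = x.steps + (f x.val).steps := rfl

end Timed

namespace RealRAM

attribute [local simp] add sub mul div sqrt log pow ceil toReal le lt RealRAM.read draw push

theorem loop_val {ι σ : Type} (body : σ → ι → Timed σ) (l : List ι) (s : σ) :
    (loop body l s).val = l.foldl (fun s i => (body s i).val) s := by
  induction l generalizing s with
  | nil => rfl
  | cons i _ ih => exact ih _

theorem loop_steps_le {ι σ : Type} {body : σ → ι → Timed σ} {c : ℕ}
    (hc : ∀ s i, (body s i).steps ≤ c) (l : List ι) (s : σ) :
    (loop body l s).steps ≤ l.length * (1 + c) := by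
  induction l generalizing s with
  | nil => simp [loop]
  | cons i l ih =>
    have hbody := hc s i
    have hrest := ih (body s i).val
    simp only [loop, List.length_cons]
    linarith

theorem fill_steps_le {k : ℕ} {α : Type} {f : Fin k → Timed α} {c : ℕ}
    (hc : ∀ i, (f i).steps ≤ c) : (fill f).steps ≤ k * (c + 1) :=
  (Finset.sum_le_sum fun i _ => Nat.succ_le_succ (hc i)).trans_eq
    (by rw [Finset.sum_const, Finset.card_univ, Fintype.card_fin, smul_eq_mul])

theorem dot_val {d : ℕ} (u v : Fin d → ℝ) : (dot u v).val = u ⬝ᵥ v := by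
  simp only [dot, loop_val, Timed.val_bind, RealRAM.read, mul, add]
  rw [dotProduct, Fin.sum_univ_def, List.sum_eq_foldl, List.foldl_map]

theorem dot_steps_le {d : ℕ} (u v : Fin d → ℝ) : (dot u v).steps ≤ 5 * d :=
  (loop_steps_le (c := 4) (by simp) _ _).trans_eq (by simp [mul_comm])

end RealRAM

namespace Top1

open RealRAM

attribute [local simp] add sub mul div RealRAM.sqrt RealRAM.log RealRAM.pow RealRAM.ceil toReal
  RealRAM.le RealRAM.lt RealRAM.read draw push step newTable RealRAM.insert dot_val

/-! ### What the programs compute -/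

/-- The first index at which `X` is maximal, `none` if there is no index at all. The Top-1 rule
stores a point in the bucket `topIndex` of its inner products with the filters. -/
noncomputable def topIndex {m : ℕ} (X : Fin m → ℝ) : Option (Fin m) :=
  (List.finRange m).argmax X

theorem le_of_mem_topIndex {m : ℕ} {X : Fin m → ℝ} {i : Fin m} (hi : i ∈ topIndex X)
    (j : Fin m) : X j ≤ X i :=
  List.le_of_mem_argmax (List.mem_finRange j) hi

theorem exists_mem_topIndex {m : ℕ} (hm : 0 < m) (X : Fin m → ℝ) : ∃ i, i ∈ topIndex X := by
  refine Option.ne_none_iff_exists'.1 fun h => hm.ne' ?_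
  rwa [topIndex, List.argmax_eq_none, List.finRange_eq_nil_iff] at h

theorem argmax_val {m d : ℕ} (A : Fin m → Fin d → ℝ) (x : Fin d → ℝ) :
    (argmax A x).val = topIndex fun i => A i ⬝ᵥ x := by
  let pair (i : Fin m) : Fin m × ℝ := (i, A i ⬝ᵥ x)
  trans ((topIndex fun i => A i ⬝ᵥ x).map pair).map Prod.fst
  · simp only [argmax, Timed.val_bind, Timed.val_pure, loop_val]
    congr 1
    refine List.foldl_hom (init := none) (Option.map pair) fun b i => ?_
    rcases b with _ | j
    · simp [pair, List.argAux]
    · simp only [List.argAux, Option.map_some, pair, dot_val, RealRAM.read, RealRAM.lt,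
        Timed.val_bind, decide_eq_true_eq]
      split_ifs <;> rfl
  · simp [pair, Function.comp_def]

theorem argmax_steps_le {m d : ℕ} (A : Fin m → Fin d → ℝ) (x : Fin d → ℝ) :
    (argmax A x).steps ≤ m * (5 * d + 3) := by
  simp only [argmax, Timed.steps_bind, Timed.steps_pure, add_zero]
  refine (loop_steps_le (c := 5 * d + 2) (fun b i => ?_) _ _).trans_eq
    (by rw [List.length_finRange]; ring)
  have hdot := dot_steps_le (A i) x
  rcases b with _ | ⟨j, w⟩ <;> simp only [Timed.steps_bind] <;> [skip; split_ifs] <;>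
    simp <;> omega

@[simp]
theorem computeNumFilters_val (α β : ℝ) (n : ℕ) :
    (computeNumFilters α β n).val = numFilters α β n := by
  simp [computeNumFilters, numFilters, sq]

/-- The query threshold `η = α √(2 log m) - √(2 (1 - α²) log log m)`. -/
noncomputable def eta (α : ℝ) (m : ℕ) : ℝ :=
  α * √(2 * Real.log m) - √(2 * (1 - α ^ 2) * Real.log (Real.log m))

@[simp]
theorem computeThreshold_val (α : ℝ) (m : ℕ) : (computeThreshold α m).val = eta α m := by
  simp [computeThreshold, eta, sq]

theorem foldl_ite_cons {ι : Type*} (p : ι → Prop) [DecidablePred p] (l : List ι) :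
    l.foldl (fun B i => if p i then i :: B else B) [] = (l.filter p).reverse := by
  rw [← List.append_nil (l.filter p).reverse, ← List.foldl_flip_cons_eq_append', List.foldl_filter]
  simp

theorem search_val {n d : ℕ} (D : DataStructure n d) (q : Fin d → ℝ) :
    (search D q).val =
      ((List.finRange D.m).filter fun i => D.threshold ≤ D.filter i ⬝ᵥ q).reverse := by
  rw [search, loop_val, ← foldl_ite_cons]
  congr! 3 with B i
  simp only [dot_val, RealRAM.read, RealRAM.le, Timed.val_bind, decide_eq_true_eq]
  split_ifs <;> rfl

theorem scanBucket_val {n d : ℕ} (D : DataStructure n d) (β : ℝ) (q : Fin d → ℝ)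
    (l : List (Fin n)) :
    (scanBucket D β q l).val = l.find? fun k => β ≤ q ⬝ᵥ D.point k := by
  induction l with
  | nil => rfl
  | cons k l ih =>
    by_cases h : β ≤ q ⬝ᵥ D.point k <;> simp [scanBucket, h, ih]

theorem scanBuckets_val {n d : ℕ} (D : DataStructure n d) (β : ℝ) (q : Fin d → ℝ)
    (l : List (Fin D.m)) :
    (scanBuckets D β q l).val = (l.flatMap D.bucket).find? fun k => β ≤ q ⬝ᵥ D.point k := by
  induction l with
  | nil => rfl
  | cons i l ih =>
    simp only [scanBuckets, Timed.val_bind, RealRAM.read, scanBucket_val, List.flatMap_cons,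
      List.find?_append, ← ih]
    rcases (D.bucket i).find? fun k => β ≤ q ⬝ᵥ D.point k with _ | k <;> rfl

theorem query_val {n d : ℕ} (D : DataStructure n d) (β : ℝ) (q : Fin d → ℝ) :
    (query D β q).val =
      ((search D q).val.flatMap D.bucket).find? fun k => β ≤ q ⬝ᵥ D.point k :=
  scanBuckets_val D β q _

/-- One insertion of the preprocessing: the point `k` of `P` goes to the bucket of its best filter
among `A`. -/
noncomputable def insertPoint {m n d : ℕ} (A : Fin m → Fin d → ℝ) (P : Fin n → Fin d → ℝ)
    (H : Fin m → List (Fin n)) (k : Fin n) : Timed (Fin m → List (Fin n)) := do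
  let x ← RealRAM.read P k
  let best ← argmax A x
  match best with
  | none => pure H
  | some i => RealRAM.insert H i k

theorem insertPoint_val_apply {m n d : ℕ} (A : Fin m → Fin d → ℝ) (P : Fin n → Fin d → ℝ)
    (H : Fin m → List (Fin n)) (k : Fin n) (i : Fin m) :
    (insertPoint A P H k).val i =
      if topIndex (fun j => A j ⬝ᵥ P k) = some i then k :: H i else H i := by
  simp only [insertPoint, Timed.val_bind, RealRAM.read, argmax_val]
  rcases topIndex fun j => A j ⬝ᵥ P k with _ | j
  · simp
  · obtain rfl | hij := eq_or_ne i j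
    · simp
    · simp [hij, hij.symm]

theorem insertPoint_steps_le {m n d : ℕ} (A : Fin m → Fin d → ℝ) (P : Fin n → Fin d → ℝ)
    (H : Fin m → List (Fin n)) (k : Fin n) :
    (insertPoint A P H k).steps ≤ m * (5 * d + 3) + 2 := by
  have hargmax := argmax_steps_le A (P k)
  simp only [insertPoint, Timed.steps_bind, RealRAM.read]
  split <;> simp <;> omega

theorem loop_insertPoint_val_apply {m n d : ℕ} (A : Fin m → Fin d → ℝ) (P : Fin n → Fin d → ℝ)
    (l : List (Fin n)) (i : Fin m) :
    (loop (insertPoint A P) l fun _ => []).val i =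
      (l.filter fun k => topIndex (fun j => A j ⬝ᵥ P k) = some i).reverse := by
  rw [loop_val, ← foldl_ite_cons]
  symm
  refine List.foldl_hom (init := fun _ => []) (fun H : Fin m → List (Fin n) => H i) fun H k => ?_
  exact (insertPoint_val_apply A P H k i).symm

/-- The inner products of `v` with the first `m` random vectors of the source `ω`. -/
def scores {d : ℕ} (m : ℕ) (v : Fin d → ℝ) (ω : ℕ × ℕ → ℝ) : Fin m → ℝ :=
  fun i => (fun j : Fin d => ω (i, j)) ⬝ᵥ v

section Build

variable {n d : ℕ} (α β : ℝ) (S : Fin n → UnitSphere d) (ω : ℕ × ℕ → ℝ)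

theorem build_m : (build α β S ω).val.m = numFilters α β n :=
  computeNumFilters_val α β n

theorem build_threshold : (build α β S ω).val.threshold = eta α (build α β S ω).val.m :=
  computeThreshold_val _ _

theorem build_bucket (i : Fin (build α β S ω).val.m) :
    (build α β S ω).val.bucket i =
      ((List.finRange n).filter fun k => topIndex (scores _ (coords (S k)) ω) = some i).reverse := 
  loop_insertPoint_val_apply _ _ _ _

theorem mem_bucket_iff (i : Fin (build α β S ω).val.m) (k : Fin n) :
    k ∈ (build α β S ω).val.bucket i ↔ i ∈ topIndex (scores _ (coords (S k)) ω) := by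
  simp [build_bucket]

theorem sum_length_bucket_le : ∑ i, ((build α β S ω).val.bucket i).length ≤ n := by
  have hcard (i : Fin (build α β S ω).val.m) : ((build α β S ω).val.bucket i).length =
      Finset.card {k : Fin n | topIndex (scores _ (coords (S k)) ω) = some i} := by
    rw [build_bucket, List.length_reverse,
      ← List.toFinset_card_of_nodup ((List.nodup_finRange n).filter _)]
    simp [List.toFinset_filter]
  have hfiber := Finset.card_eq_sum_card_fiberwise (s := Finset.univ) (t := Finset.univ)
    (f := fun k : Fin n => topIndex (scores (build α β S ω).val.m (coords (S k)) ω)) (by simp)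
  rw [Finset.card_univ, Fintype.card_fin, Fintype.sum_option] at hfiber
  simp only [hcard]
  omega

theorem sim_eq_dotProduct (x y : UnitSphere d) : sim x y = coords x ⬝ᵥ coords y := by
  simp [sim, coords, PiLp.inner_apply, dotProduct, mul_comm]

variable {α β S ω} in
theorem Inspected.succeeds {q : UnitSphere d} {k : Fin n} (h : Inspected α β S q ω k)
    (hk : β ≤ sim q (S k)) : Succeeds α β S q ω := by
  obtain ⟨i, hi, hik⟩ := h
  have hk' : β ≤ coords q ⬝ᵥ (build α β S ω).val.point k := hk.trans_eq (sim_eq_dotProduct _ _)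
  have hsome : (query (build α β S ω).val β (coords q)).val.isSome := by
    rw [query_val, List.find?_isSome]
    exact ⟨k, List.mem_flatMap.2 ⟨i, hi, hik⟩, decide_eq_true hk'⟩
  obtain ⟨j, hj⟩ := Option.isSome_iff_exists.1 hsome
  have hsound := List.find?_some ((query_val _ _ _).symm.trans hj)
  rw [decide_eq_true_eq] at hsound
  exact ⟨j, hj, hsound.trans_eq (sim_eq_dotProduct _ _).symm⟩

/-- The event that the point `x` lies in a bucket inspected by the query `q`, when `m` filters and
the query threshold `η` are used: `x` and `q` collide. -/
def collision {d : ℕ} (m : ℕ) (η : ℝ) (x q : Fin d → ℝ) : Set (ℕ × ℕ → ℝ) :=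
  {ω | ∃ i ∈ topIndex (scores m x ω), η ≤ scores m q ω i}

theorem inspected_iff (q : UnitSphere d) (k : Fin n) :
    Inspected α β S q ω k ↔
      ω ∈ collision (numFilters α β n) (eta α (numFilters α β n)) (coords (S k)) (coords q) := by
  rw [← build_m α β S ω]
  refine exists_congr fun i => ?_
  rw [mem_bucket_iff, search_val, and_comm, List.mem_reverse, List.mem_filter, build_threshold,
    decide_eq_true_iff]
  exact and_congr_right' (and_iff_right (List.mem_finRange i))

theorem numInspected_eq_ncard (q : UnitSphere d) :
    numInspected α β S q ω =
      {i | eta α (numFilters α β n) ≤ scores (numFilters α β n) (coords q) ω i}.ncard := by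
  rw [← build_m α β S ω, numInspected, search_val, List.length_reverse, build_threshold,
    ← List.toFinset_card_of_nodup ((List.nodup_finRange _).filter _), ← Set.ncard_coe_finset]
  congr 1
  ext i
  simp only [List.toFinset_filter, List.toFinset_finRange, decide_eq_true_eq, Finset.coe_filter,
    Finset.mem_univ, true_and]
  rfl

end Build

/-! ### Time -/

section Cost

variable {n d : ℕ}

theorem search_steps_le (D : DataStructure n d) (q : Fin d → ℝ) :
    (search D q).steps ≤ D.m * (5 * d + 4) := by
  refine (loop_steps_le (c := 5 * d + 3) (fun B i => ?_) _ _).trans_eq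
    (by rw [List.length_finRange]; ring)
  have hdot := dot_steps_le (D.filter i) q
  simp only [Timed.steps_bind]
  split_ifs <;> simp <;> omega

theorem scanBucket_steps_le (D : DataStructure n d) (β : ℝ) (q : Fin d → ℝ) (l : List (Fin n)) :
    (scanBucket D β q l).steps ≤ l.length * (5 * d + 3) := by
  induction l with
  | nil => simp [scanBucket]
  | cons k l ih =>
    have hdot := dot_steps_le q (D.point k)
    simp only [scanBucket, Timed.steps_bind, List.length_cons, add_one_mul]
    split_ifs <;> simp <;> omega

theorem scanBuckets_steps_le (D : DataStructure n d) (β : ℝ) (q : Fin d → ℝ)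
    (l : List (Fin D.m)) :
    (scanBuckets D β q l).steps ≤
      l.length * 2 + (l.map fun i => (D.bucket i).length).sum * (5 * d + 3) := by
  induction l with
  | nil => simp [scanBuckets]
  | cons i l ih =>
    have hbucket := scanBucket_steps_le D β q (D.bucket i)
    simp only [scanBuckets, Timed.steps_bind, step, RealRAM.read, List.length_cons, List.map_cons,
      List.sum_cons, add_mul]
    rcases (scanBucket D β q (D.bucket i)).val with _ | k <;> simp <;> omega

theorem query_steps_le (D : DataStructure n d) (β : ℝ) (q : Fin d → ℝ) :
    (query D β q).steps ≤ D.m * (5 * d + 6) + (∑ i, (D.bucket i).length) * (5 * d + 3) := by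
  have hsub : ((search D q).val.reverse).Sublist (List.finRange D.m) := by
    rw [search_val, List.reverse_reverse]
    exact List.filter_sublist
  have hlength : (search D q).val.length ≤ D.m := by simpa using hsub.length_le
  have hentries : ((search D q).val.map fun i => (D.bucket i).length).sum ≤
      ∑ i, (D.bucket i).length := by
    rw [← List.sum_reverse, ← List.map_reverse, Fin.sum_univ_def]
    exact (hsub.map _).sum_le_sum (by simp)
  calc (query D β q).steps
      = (search D q).steps + (scanBuckets D β q (search D q).val).steps := rfl
    _ ≤ D.m * (5 * d + 4) + (D.m * 2 + (∑ i, (D.bucket i).length) * (5 * d + 3)) := by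
      grw [search_steps_le, scanBuckets_steps_le, hlength, hentries]
    _ = _ := by ring

theorem computeNumFilters_steps (α β : ℝ) : (computeNumFilters α β n).steps = 9 := by
  simp [computeNumFilters]

theorem computeThreshold_steps (α : ℝ) (m : ℕ) : (computeThreshold α m).steps = 12 := by
  simp [computeThreshold]

theorem fill_fill_steps_le {k l : ℕ} {f : Fin k → Fin l → Timed ℝ}
    (hf : ∀ i j, (f i j).steps ≤ 1) : (fill fun i => fill (f i)).steps ≤ k * (2 * l + 1) :=
  fill_steps_le fun i => (fill_steps_le (hf i)).trans_eq (mul_comm _ _)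

theorem construct_steps_le (α β : ℝ) (S : Fin n → Fin d → ℝ) (ω : ℕ × ℕ → ℝ) :
    (construct α β S ω).steps ≤ 21 + numFilters α β n * (2 * d + 2) + n * (2 * d + 1) +
      n * (numFilters α β n * (5 * d + 3) + 3) := by
  calc (construct α β S ω).steps
      = (computeNumFilters α β n).steps +
        ((fill fun i : Fin (computeNumFilters α β n).val =>
          fill fun j : Fin d => draw ω i j).steps +
        ((fill fun k => fill fun j => RealRAM.read (S k) j).steps +
        ((computeNumFilters α β n).val + ((loop (insertPoint _ _) (List.finRange n) _).steps +
        ((computeThreshold α (computeNumFilters α β n).val).steps + 0))))) := rfl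
    _ ≤ 9 + (numFilters α β n * (2 * d + 1) + (n * (2 * d + 1) + (numFilters α β n +
        (n * (1 + (numFilters α β n * (5 * d + 3) + 2)) + (12 + 0))))) := by
      grw [fill_fill_steps_le fun _ _ => le_rfl, fill_fill_steps_le fun _ _ => le_rfl,
        loop_steps_le (insertPoint_steps_le _ _), computeNumFilters_steps,
        computeThreshold_steps, computeNumFilters_val, List.length_finRange]
    _ = _ := by ring

end Cost

/-! ### The inner products with the filters as Gaussian vectors -/

instance : IsProbabilityMeasure gaussianSource := by
  unfold gaussianSource; infer_instance

theorem map_eval_gaussianSource (p : ℕ × ℕ) :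
    gaussianSource.map (fun ω => ω p) = gaussianReal 0 1 :=
  Measure.infinitePi_map_eval _ p

theorem hasGaussianLaw_eval (p : ℕ × ℕ) : HasGaussianLaw (fun ω => ω p) gaussianSource := by
  have : IsGaussian (gaussianSource.map fun ω => ω p) := by
    rw [map_eval_gaussianSource]; infer_instance
  exact IsGaussian.hasGaussianLaw

theorem iIndepFun_eval : iIndepFun (fun (p : ℕ × ℕ) (ω : ℕ × ℕ → ℝ) => ω p) gaussianSource :=
  iIndepFun_infinitePi (X := fun _ x => x) fun _ => measurable_id

theorem integral_eval (p : ℕ × ℕ) : ∫ ω, ω p ∂gaussianSource = 0 := by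
  have hmap : ∫ x, x ∂(gaussianSource.map fun ω => ω p) = ∫ ω, ω p ∂gaussianSource :=
    integral_map (measurable_pi_apply p).aemeasurable (by fun_prop)
  rw [← hmap, map_eval_gaussianSource, integral_id_gaussianReal]

theorem covariance_eval (p q : ℕ × ℕ) :
    cov[fun ω => ω p, fun ω => ω q; gaussianSource] = if p = q then 1 else 0 := by
  split_ifs with h
  · subst h
    rw [covariance_self (measurable_pi_apply p).aemeasurable,
      ← variance_id_map (measurable_pi_apply p).aemeasurable, map_eval_gaussianSource,
      variance_id_gaussianReal, NNReal.coe_one]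
  · exact (iIndepFun_eval.indepFun h).covariance_eq_zero (hasGaussianLaw_eval p).memLp_two
      (hasGaussianLaw_eval q).memLp_two

theorem hasGaussianLaw_entries (m d : ℕ) :
    HasGaussianLaw (fun (ω : ℕ × ℕ → ℝ) (p : Fin m × Fin d) => ω (p.1.val, p.2.val))
      gaussianSource :=
  (iIndepFun_eval.precomp (g := fun p : Fin m × Fin d => (p.1.val, p.2.val))
    (Fin.val_injective.prodMap Fin.val_injective)).hasGaussianLaw fun _ => hasGaussianLaw_eval _

theorem dotProduct_self_nonneg {ι : Type*} [Fintype ι] (v : ι → ℝ) : 0 ≤ v ⬝ᵥ v :=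
  dotProduct_star_self_nonneg v

section Scores

variable {m d : ℕ} (u v : Fin d → ℝ)

variable (m) in
/-- The product with the vector `v` of a matrix with `m` rows, as a continuous linear map; it turns
the random matrix of the filters into `scores m v`. -/
noncomputable def scoresCLM : (Fin m × Fin d → ℝ) →L[ℝ] (Fin m → ℝ) :=
  ContinuousLinearMap.pi fun i => ∑ j, v j • ContinuousLinearMap.proj (i, j)

variable (m) in
theorem scoresCLM_entries (ω : ℕ × ℕ → ℝ) :
    scoresCLM m v (fun p => ω (p.1.val, p.2.val)) = scores m v ω := by
  ext i
  simp [scoresCLM, scores, dotProduct, mul_comm]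

@[fun_prop]
theorem measurable_scores : Measurable (scores m v) := by
  unfold scores dotProduct
  fun_prop

theorem hasGaussianLaw_scores : HasGaussianLaw (scores m v) gaussianSource := by
  simpa only [scoresCLM_entries] using
    (hasGaussianLaw_entries m d).map_fun (scoresCLM m v)

theorem hasGaussianLaw_scores_prodMk :
    HasGaussianLaw (fun ω => (scores m u ω, scores m v ω)) gaussianSource := by
  simpa only [ContinuousLinearMap.prod_apply, scoresCLM_entries] using
    (hasGaussianLaw_entries m d).map_fun ((scoresCLM m u).prod (scoresCLM m v))

theorem integral_scores (i : Fin m) : ∫ ω, scores m v ω i ∂gaussianSource = 0 := by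
  simp only [scores, dotProduct]
  rw [integral_finsetSum _ fun j _ => (hasGaussianLaw_eval _).integrable.mul_const _]
  simp [integral_mul_const, integral_eval]

theorem covariance_scores (i j : Fin m) :
    cov[fun ω => scores m u ω i, fun ω => scores m v ω j; gaussianSource] =
      if i = j then u ⬝ᵥ v else 0 := by
  have hL2 (w : Fin d → ℝ) (l : Fin m) (k : Fin d) :
      MemLp (fun ω : ℕ × ℕ → ℝ => ω (l, k) * w k) 2 gaussianSource :=
    (hasGaussianLaw_eval _).memLp_two.mul_const _
  simp only [scores, dotProduct]
  rw [covariance_fun_sum_fun_sum (hL2 u i) (hL2 v j)]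
  simp only [covariance_mul_const_left, covariance_mul_const_right, covariance_eval,
    Prod.mk.injEq, Fin.val_inj]
  split_ifs with hij <;> simp [hij, mul_comm]

theorem map_scores (i : Fin m) :
    gaussianSource.map (fun ω => scores m v ω i) = gaussianReal 0 (v ⬝ᵥ v).toNNReal := by
  rw [((hasGaussianLaw_scores v).eval i).map_eq_gaussianReal, integral_scores,
    ← covariance_self (by fun_prop), covariance_scores, if_pos rfl]

theorem iIndepFun_scores :
    iIndepFun (fun (i : Fin m) ω => scores m v ω i) gaussianSource :=
  (hasGaussianLaw_scores v).iIndepFun_of_covariance_eq_zero fun i j hij => by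
    rw [covariance_scores, if_neg hij]

variable {u v}

theorem indepFun_scores (huv : u ⬝ᵥ v = 0) :
    IndepFun (scores m u) (scores m v) gaussianSource :=
  (hasGaussianLaw_scores_prodMk u v).indepFun_of_covariance_eval fun i j => by
    rw [covariance_scores, huv, ite_self]

theorem hasSubgaussianMGF_scores {V : NNReal} (hV : v ⬝ᵥ v ≤ V) (i : Fin m) :
    HasSubgaussianMGF (fun ω => scores m v ω i) V gaussianSource where
  integrable_exp_mul s := by
    have hexp := integrable_exp_mul_gaussianReal (μ := 0) (v := (v ⬝ᵥ v).toNNReal) s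
    rw [← map_scores v i] at hexp
    exact hexp.comp_measurable (by fun_prop)
  mgf_le s := by
    rw [mgf_gaussianReal (map_scores v i), zero_mul, zero_add,
      Real.coe_toNNReal _ (dotProduct_self_nonneg v)]
    gcongr

theorem measure_le_scores_le {V : ℝ} (hV : v ⬝ᵥ v ≤ V) (i : Fin m) (t : ℝ) :
    gaussianSource {ω | t ≤ scores m v ω i} ≤ ENNReal.ofReal (Real.exp (-t⁺ ^ 2 / (2 * V))) := by
  rcases le_total t 0 with ht | ht
  · simpa [posPart_eq_zero.2 ht] using prob_le_one
  · lift V to NNReal using hV.trans' (dotProduct_self_nonneg v)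
    rw [posPart_eq_self.2 ht, ← ofReal_measureReal]
    exact ENNReal.ofReal_le_ofReal ((hasSubgaussianMGF_scores hV i).measure_ge_le ht)

theorem measure_scores_le_le {V : ℝ} (hV : v ⬝ᵥ v ≤ V) (i : Fin m) (t : ℝ) :
    gaussianSource {ω | scores m v ω i ≤ t} ≤ ENNReal.ofReal (Real.exp (-t⁻ ^ 2 / (2 * V))) := by
  have hneg := measure_le_scores_le (v := -v) (by simpa using hV) i (-t)
  simpa [scores, negPart_def, posPart_def] using hneg

theorem measure_forall_scores_mem (hv : v ⬝ᵥ v = 1) {B : Set ℝ} (hB : MeasurableSet B) :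
    gaussianSource {ω | ∀ i : Fin m, scores m v ω i ∈ B} = gaussianReal 0 1 B ^ m := by
  have hinter : {ω | ∀ i : Fin m, scores m v ω i ∈ B} =
      ⋂ i ∈ (Finset.univ : Finset (Fin m)), (fun ω => scores m v ω i) ⁻¹' B := by
    ext ω; simp
  rw [hinter, (iIndepFun_scores v).measure_inter_preimage_eq_mul _ fun _ _ => hB,
    Finset.prod_congr rfl fun i _ => (Measure.map_apply (by fun_prop) hB).symm]
  simp [map_scores, hv]

theorem mem_topIndex_iff {X : Fin m → ℝ} {i : Fin m} :
    i ∈ topIndex X ↔ (∀ j, X j ≤ X i) ∧ ∀ j, X i ≤ X j → i ≤ j := by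
  simp [topIndex, List.argmax_eq_some_iff]

theorem measurableSet_mem_topIndex (i : Fin m) :
    MeasurableSet {X : Fin m → ℝ | i ∈ topIndex X} := by
  simp only [mem_topIndex_iff]
  measurability

end Scores

theorem measure_iUnion_inter_le {Ω ι : Type*} [MeasurableSpace Ω] [Countable ι] {μ : Measure Ω}
    [IsProbabilityMeasure μ] {F G : ι → Set Ω} {p : ENNReal} (hF : ∀ i, MeasurableSet (F i))
    (hdisj : Pairwise (Function.onFun Disjoint F)) (hFG : ∀ i, IndepSet (F i) (G i) μ)
    (hG : ∀ i, μ (G i) ≤ p) : μ (⋃ i, F i ∩ G i) ≤ p :=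
  calc μ (⋃ i, F i ∩ G i)
      ≤ ∑' i, μ (F i ∩ G i) := measure_iUnion_le _
    _ ≤ ∑' i, μ (F i) * p := by
      gcongr with i
      rw [(hFG i).measure_inter_eq_mul]
      grw [hG i]
    _ = μ (⋃ i, F i) * p := by rw [ENNReal.tsum_mul_right, measure_iUnion hdisj hF]
    _ ≤ p := mul_le_of_le_one_left' prob_le_one

theorem measure_exists_mem_topIndex_le {m d : ℕ} {u v : Fin d → ℝ} (huv : u ⬝ᵥ v = 0)
    {B : Set ℝ} (hB : MeasurableSet B) {p : ENNReal}
    (hp : ∀ i, gaussianSource {ω | scores m v ω i ∈ B} ≤ p) :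
    gaussianSource {ω | ∃ i ∈ topIndex (scores m u ω), scores m v ω i ∈ B} ≤ p := by
  have hunion : {ω | ∃ i ∈ topIndex (scores m u ω), scores m v ω i ∈ B} =
      ⋃ i, scores m u ⁻¹' {X | i ∈ topIndex X} ∩ scores m v ⁻¹' {Y | Y i ∈ B} := by
    ext ω; simp
  rw [hunion]
  refine measure_iUnion_inter_le
    (fun i => (measurableSet_mem_topIndex i).preimage (measurable_scores u)) ?_ (fun i => ?_) hp
  · exact fun i j hij => Set.disjoint_left.2 fun ω hi hj => hij (Option.mem_unique hi hj)
  · exact (indepFun_iff_indepSet_preimage (measurable_scores u) (measurable_scores v)).1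
      (indepFun_scores huv) _ _ (measurableSet_mem_topIndex i)
      (hB.preimage (measurable_pi_apply i))

theorem gaussianReal_Iio_zero_le (v : NNReal) : gaussianReal 0 v (Set.Iio 0) ≤ 2⁻¹ := by
  have hsymm : gaussianReal 0 v (Set.Ioi 0) = gaussianReal 0 v (Set.Iio 0) := by
    conv_lhs => rw [← neg_zero, ← gaussianReal_map_neg, Measure.map_apply measurable_neg (by simp)]
    simp
  have htwo : gaussianReal 0 v (Set.Iio 0) * 2 ≤ 1 := by
    conv_lhs => rw [mul_two]; arg 2; rw [← hsymm]
    have hdisj : Disjoint (Set.Iio (0 : ℝ)) (Set.Ioi 0) :=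
      Set.disjoint_left.2 fun x hx hx' => lt_asymm (Set.mem_Iio.1 hx) hx'
    rw [← measure_union hdisj measurableSet_Ioi]
    exact prob_le_one
  exact ENNReal.le_inv_iff_mul_le.2 htwo

theorem mul_gaussianPDFReal_le_Ici {v : NNReal} (hv : v ≠ 0) {t δ : ℝ} (ht : 0 ≤ t) (hδ : 0 ≤ δ) :
    δ * gaussianPDFReal 0 v (t + δ) ≤ (gaussianReal 0 v).real (Set.Ici t) :=
  calc δ * gaussianPDFReal 0 v (t + δ)
      = ∫ _ in Set.Icc t (t + δ), gaussianPDFReal 0 v (t + δ) := by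
        simp [hδ]
    _ ≤ ∫ x in Set.Icc t (t + δ), gaussianPDFReal 0 v x := by
        refine setIntegral_mono_on (integrableOn_const (by simp))
          (integrable_gaussianPDFReal 0 v).integrableOn measurableSet_Icc fun x hx => ?_
        have hx0 : 0 ≤ x := ht.trans hx.1
        have hxt := hx.2
        simp only [gaussianPDFReal, sub_zero]
        gcongr
    _ = (gaussianReal 0 v).real (Set.Icc t (t + δ)) := by
        rw [measureReal_def, gaussianReal_apply_eq_integral _ hv, ENNReal.toReal_ofReal]
        exact setIntegral_nonneg measurableSet_Icc fun x _ => gaussianPDFReal_nonneg _ _ _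
    _ ≤ (gaussianReal 0 v).real (Set.Ici t) := measureReal_mono Set.Icc_subset_Ici_self

/-! ### The collision probability -/

section Collision

variable {m d : ℕ}

theorem scores_linearCombination (a b : ℝ) (x q : Fin d → ℝ) (ω : ℕ × ℕ → ℝ) (i : Fin m) :
    scores m (a • x + b • q) ω i = a * scores m x ω i + b * scores m q ω i := by
  simp [scores, dotProduct_add, dotProduct_smul]

theorem scores_eq_add_residual (s : ℝ) (x q : Fin d → ℝ) (ω : ℕ × ℕ → ℝ) (i : Fin m) :
    scores m q ω i = s * scores m x ω i + scores m (q - s • x) ω i := by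
  simp [scores, dotProduct_sub, dotProduct_smul]

variable {x q : Fin d → ℝ} {s : ℝ} (hx : x ⬝ᵥ x = 1) (hq : q ⬝ᵥ q = 1) (hs : x ⬝ᵥ q = s)

include hx hs in
theorem dotProduct_residual : x ⬝ᵥ (q - s • x) = 0 := by
  simp [dotProduct_sub, dotProduct_smul, hx, hs]

include hx hq hs in
theorem dotProduct_self_linearCombination (a b : ℝ) :
    (a • x + b • q) ⬝ᵥ (a • x + b • q) = a ^ 2 + 2 * a * b * s + b ^ 2 := by
  simp only [dotProduct_add, add_dotProduct, dotProduct_smul, smul_dotProduct, hx, hq, hs,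
    dotProduct_comm q x, smul_eq_mul]
  ring

include hx hq hs in
theorem dotProduct_self_residual : (q - s • x) ⬝ᵥ (q - s • x) = 1 - s ^ 2 := by
  have hlin := dotProduct_self_linearCombination hx hq hs (-s) 1
  rw [neg_smul, one_smul, neg_add_eq_sub] at hlin
  rw [hlin]
  ring

include hx hq hs in
/-- A near point is missed only if its largest inner product with a filter is small, or if the
query has a small component, orthogonally to the point, along the filter of the point's bucket. -/
theorem measure_compl_collision_le (hm : 0 < m) {α η t : ℝ} (hα : 0 ≤ α) (hαs : α ≤ s)
    (ht : 0 ≤ t) :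
    gaussianSource (collision m η x q)ᶜ ≤ gaussianReal 0 1 (Set.Iio t) ^ m +
      ENNReal.ofReal (Real.exp (-(α * t - η)⁺ ^ 2 / (2 * (1 - α ^ 2)))) := by
  have hsub : (collision m η x q)ᶜ ⊆ {ω | ∀ i : Fin m, scores m x ω i ∈ Set.Iio t} ∪
      {ω | ∃ i ∈ topIndex (scores m x ω), scores m (q - s • x) ω i ∈ Set.Iic (η - α * t)} := by
    intro ω hω
    obtain ⟨i, hi⟩ := exists_mem_topIndex hm (scores m x ω)
    rcases lt_or_ge (scores m x ω i) t with hlt | hge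
    · exact Or.inl fun j => (le_of_mem_topIndex hi j).trans_lt hlt
    · refine Or.inr ⟨i, hi, Set.mem_Iic.2 ?_⟩
      have hlow : scores m q ω i < η := not_le.1 fun hle => hω ⟨i, hi, hle⟩
      rw [scores_eq_add_residual s x q] at hlow
      nlinarith [mul_le_mul hαs hge ht (hα.trans hαs)]
  refine (measure_mono hsub).trans ((measure_union_le _ _).trans ?_)
  gcongr
  · exact (measure_forall_scores_mem hx measurableSet_Iio).le
  · refine measure_exists_mem_topIndex_le (dotProduct_residual hx hs) measurableSet_Iic fun i => ?_
    rw [← neg_sub η, posPart_neg]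
    refine measure_scores_le_le ?_ i _
    rw [dotProduct_self_residual hx hq hs]
    gcongr

include hx hq hs in
theorem measure_le_scores_and_le_scores_le (hs1 : s ^ 2 < 1) {a η : ℝ} (ha : 0 ≤ a)
    (hsη : s * η ≤ a) (i : Fin m) :
    gaussianSource {ω | a ≤ scores m x ω i ∧ η ≤ scores m q ω i} ≤
      ENNReal.ofReal (Real.exp (-a ^ 2 / 2) *
        Real.exp (-(η - s * a)⁺ ^ 2 / (2 * (1 - s ^ 2)))) := by
  have hV : 0 < 1 - s ^ 2 := sub_pos.2 hs1
  rcases le_total (η - s * a) 0 with he | he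
  · have htail := measure_le_scores_le hx.le i a
    rw [posPart_eq_self.2 ha, mul_one] at htail
    rw [posPart_eq_zero.2 he]
    simpa using (measure_mono fun ω hω => hω.1).trans htail
  set c := a - s * η with hc
  set e := η - s * a with he'
  set D := c * a + e * η with hD
  have hD_eq : D = (1 - s ^ 2) * a ^ 2 + e ^ 2 := by rw [hD, hc, he']; ring
  have hD0 : 0 ≤ D := by rw [hD_eq]; positivity
  have hnorm : (c • x + e • q) ⬝ᵥ (c • x + e • q) = (1 - s ^ 2) * D := by
    rw [dotProduct_self_linearCombination hx hq hs, hD_eq, hc, he']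
    ring
  calc gaussianSource {ω | a ≤ scores m x ω i ∧ η ≤ scores m q ω i}
      ≤ gaussianSource {ω | D ≤ scores m (c • x + e • q) ω i} := by
        refine measure_mono fun ω hω => ?_
        rw [Set.mem_ofPred_eq, scores_linearCombination]
        exact add_le_add (mul_le_mul_of_nonneg_left hω.1 (sub_nonneg.2 hsη))
          (mul_le_mul_of_nonneg_left hω.2 he)
    _ ≤ ENNReal.ofReal (Real.exp (-D⁺ ^ 2 / (2 * ((1 - s ^ 2) * D)))) :=
        measure_le_scores_le hnorm.le i D
    _ = _ := by
        rw [posPart_eq_self.2 hD0, posPart_eq_self.2 he, ← Real.exp_add]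
        congr 2
        rw [show -D ^ 2 / (2 * ((1 - s ^ 2) * D)) = -D / (2 * (1 - s ^ 2)) by
          rcases eq_or_ne D 0 with h | h
          · simp [h]
          · field_simp, hD_eq]
        field_simp
        ring

include hx hq hs in
/-- The best filter of the point is either one of the few with inner product at least `a` with the
point, or it must have a large component along the query orthogonally to the point. -/
theorem measure_collision_le (hs0 : 0 ≤ s) (hs1 : s < 1) {a η : ℝ} (ha : 0 ≤ a) (hηa : η ≤ a) :
    gaussianSource (collision m η x q) ≤
      ENNReal.ofReal ((m * Real.exp (-a ^ 2 / 2) + 1) *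
        Real.exp (-(η - s * a)⁺ ^ 2 / (2 * (1 - s ^ 2)))) := by
  have hsub : collision m η x q ⊆
      (⋃ i : Fin m, {ω | a ≤ scores m x ω i ∧ η ≤ scores m q ω i}) ∪
        {ω | ∃ i ∈ topIndex (scores m x ω), scores m (q - s • x) ω i ∈ Set.Ici (η - s * a)} := by
    rintro ω ⟨i, hi, hηi⟩
    rcases le_total a (scores m x ω i) with hge | hle
    · exact Or.inl (Set.mem_iUnion.2 ⟨i, hge, hηi⟩)
    · refine Or.inr ⟨i, hi, Set.mem_Ici.2 ?_⟩
      rw [scores_eq_add_residual s x q] at hηi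
      linarith [mul_le_mul_of_nonneg_left hle hs0]
  have hsη : s * η ≤ a := by nlinarith
  rw [add_mul, one_mul, ENNReal.ofReal_add (by positivity) (by positivity)]
  refine (measure_mono hsub).trans ((measure_union_le _ _).trans ?_)
  gcongr
  · refine (measure_iUnion_fintype_le _ _).trans ((Finset.sum_le_sum fun i _ =>
      measure_le_scores_and_le_scores_le hx hq hs (by nlinarith) ha hsη i).trans_eq ?_)
    rw [Finset.sum_const, Finset.card_univ, Fintype.card_fin, nsmul_eq_mul,
      ← ENNReal.ofReal_natCast, ← ENNReal.ofReal_mul (by positivity), mul_assoc]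
  · exact measure_exists_mem_topIndex_le (dotProduct_residual hx hs) measurableSet_Ici fun i =>
      measure_le_scores_le (dotProduct_self_residual hx hq hs).le i _

include hx hq hs in
theorem measure_collision_le_of_nonpos (hs0 : s ≤ 0) (η : ℝ) :
    gaussianSource (collision m η x q) ≤
      2⁻¹ ^ m + ENNReal.ofReal (Real.exp (-η⁺ ^ 2 / 2)) := by
  have hsub : collision m η x q ⊆ {ω | ∀ i : Fin m, scores m x ω i ∈ Set.Iio 0} ∪
      {ω | ∃ i ∈ topIndex (scores m x ω), scores m (q - s • x) ω i ∈ Set.Ici η} := by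
    rintro ω ⟨i, hi, hηi⟩
    rcases lt_or_ge (scores m x ω i) 0 with hlt | hge
    · exact Or.inl fun j => (le_of_mem_topIndex hi j).trans_lt hlt
    · refine Or.inr ⟨i, hi, Set.mem_Ici.2 ?_⟩
      rw [scores_eq_add_residual s x q] at hηi
      linarith [mul_nonpos_of_nonpos_of_nonneg hs0 hge]
  refine (measure_mono hsub).trans ((measure_union_le _ _).trans ?_)
  gcongr
  · rw [measure_forall_scores_mem hx measurableSet_Iio]
    gcongr
    exact gaussianReal_Iio_zero_le 1
  · refine measure_exists_mem_topIndex_le (dotProduct_residual hx hs) measurableSet_Ici fun i => ?_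
    have hV : (q - s • x) ⬝ᵥ (q - s • x) ≤ 1 := by
      rw [dotProduct_self_residual hx hq hs]
      linarith [sq_nonneg s]
    simpa using measure_le_scores_le hV i η

end Collision

/-! ### Expectations -/

theorem lintegral_ncard_le {Ω ι : Type*} [MeasurableSpace Ω] [Fintype ι] (μ : Measure Ω)
    (E : ι → Set Ω) : ∫⁻ ω, ({k | ω ∈ E k}.ncard : ENNReal) ∂μ ≤ ∑ k, μ (E k) := by
  classical
  calc ∫⁻ ω, ({k | ω ∈ E k}.ncard : ENNReal) ∂μ
      ≤ ∫⁻ ω, ∑ k, (toMeasurable μ (E k)).indicator 1 ω ∂μ := by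
        refine lintegral_mono fun ω => ?_
        rw [Set.ncard_eq_toFinset_card', Set.toFinset_ofPred, Finset.card_filter, Nat.cast_sum]
        gcongr with k
        rw [Nat.cast_ite, Nat.cast_one, Nat.cast_zero, ← Pi.one_apply (M := fun _ => ENNReal) ω]
        exact Set.indicator_le_indicator_of_subset (subset_toMeasurable μ (E k)) (by simp) ω
    _ = ∑ k, μ (E k) := by
        rw [lintegral_finsetSum _ fun k _ =>
          measurable_one.indicator (measurableSet_toMeasurable μ (E k))]
        simp [measurableSet_toMeasurable]

theorem dotProduct_self_coords {d : ℕ} (x : UnitSphere d) : coords x ⬝ᵥ coords x = 1 := by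
  rw [← sim_eq_dotProduct, sim, real_inner_self_eq_norm_sq]
  simp

section Expectations

variable {n d : ℕ} {α β : ℝ} {S : Fin n → UnitSphere d} {q : UnitSphere d}

theorem lintegral_numInspected_le :
    ∫⁻ ω, (numInspected α β S q ω : ENNReal) ∂gaussianSource ≤
      ENNReal.ofReal (numFilters α β n * Real.exp (-(eta α (numFilters α β n))⁺ ^ 2 / 2)) := by
  simp only [numInspected_eq_ncard]
  refine (lintegral_ncard_le gaussianSource fun i : Fin (numFilters α β n) =>
    {ω | eta α (numFilters α β n) ≤ scores _ (coords q) ω i}).trans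
    ((Finset.sum_le_sum fun i _ => measure_le_scores_le (dotProduct_self_coords q).le i _).trans_eq
      ?_)
  rw [Finset.sum_const, Finset.card_univ, Fintype.card_fin, nsmul_eq_mul, mul_one,
    ENNReal.ofReal_mul (Nat.cast_nonneg _), ENNReal.ofReal_natCast]

theorem lintegral_numFar_le {p : ENNReal}
    (hp : ∀ k, sim q (S k) < β → gaussianSource {ω | Inspected α β S q ω k} ≤ p) :
    ∫⁻ ω, (numFar α β S q ω : ENNReal) ∂gaussianSource ≤ n * p := by
  refine (lintegral_ncard_le gaussianSource fun k =>
    {ω | sim q (S k) < β ∧ Inspected α β S q ω k}).trans ?_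
  have hk (k : Fin n) : gaussianSource {ω | sim q (S k) < β ∧ Inspected α β S q ω k} ≤ p := by
    by_cases hfar : sim q (S k) < β
    · simpa [hfar] using hp k hfar
    · simp [hfar]
  exact (Finset.sum_le_sum fun k _ => hk k).trans_eq (by simp)

end Expectations

/-! ### The exponents -/

theorem one_sub_sq_pos {x : ℝ} (hx0 : 0 ≤ x) (hx1 : x < 1) : 0 < 1 - x ^ 2 := by nlinarith

section Parameters

variable {α β : ℝ} {n : ℕ} (hβ : 0 ≤ β) (hβα : β ≤ α) (hα : α < 1)
include hβ hβα hα

theorem one_sub_mul_pos : 0 < 1 - α * β := by nlinarith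

theorem rho_nonneg : 0 ≤ rho α β :=
  div_nonneg (mul_nonneg (one_sub_sq_pos (hβ.trans hβα) hα).le
    (one_sub_sq_pos hβ (hβα.trans_lt hα)).le) (sq_nonneg _)

theorem rho_div_one_sub_sq : rho α β / (1 - α ^ 2) = (1 - β ^ 2) / (1 - α * β) ^ 2 := by
  have hα2 := (one_sub_sq_pos (hβ.trans hβα) hα).ne'
  have hαβ := (one_sub_mul_pos hβ hβα hα).ne'
  rw [rho]
  field_simp

theorem one_sub_rho :
    1 - rho α β = (α - β) ^ 2 / (1 - β ^ 2) * (rho α β / (1 - α ^ 2)) := by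
  have hβ2 := (one_sub_sq_pos hβ (hβα.trans_lt hα)).ne'
  have hαβ := (one_sub_mul_pos hβ hβα hα).ne'
  rw [rho_div_one_sub_sq hβ hβα hα, rho]
  field_simp
  ring

theorem one_le_rho_div : 1 ≤ rho α β / (1 - α ^ 2) := by
  have hαβ := one_sub_mul_pos hβ hβα hα
  have hβα2 : 1 - α * β ≤ 1 - β ^ 2 := by nlinarith
  have hle : 1 - α * β ≤ 1 := by nlinarith
  rw [rho_div_one_sub_sq hβ hβα hα, one_le_div (pow_pos hαβ 2)]
  exact (pow_le_of_le_one hαβ.le hle two_ne_zero).trans hβα2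

theorem rho_le_one : rho α β ≤ 1 := by
  have hβ2 := one_sub_sq_pos hβ (hβα.trans_lt hα)
  have hexp := zero_le_one.trans (one_le_rho_div hβ hβα hα)
  rw [← sub_nonneg, one_sub_rho hβ hβα hα]
  positivity

theorem rpow_le_numFilters :
    (n : ℝ) ^ (rho α β / (1 - α ^ 2)) ≤ numFilters α β n :=
  rho_div_one_sub_sq hβ hβα hα ▸ Nat.le_ceil _

theorem le_rpow_rho_div (hn : 1 ≤ n) : (n : ℝ) ≤ (n : ℝ) ^ (rho α β / (1 - α ^ 2)) :=
  Real.self_le_rpow_of_one_le (Nat.one_le_cast.2 hn) (one_le_rho_div hβ hβα hα)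

theorem le_numFilters (hn : 1 ≤ n) : n ≤ numFilters α β n := by
  exact_mod_cast (le_rpow_rho_div hβ hβα hα hn).trans (rpow_le_numFilters hβ hβα hα)

theorem numFilters_le (hn : 1 ≤ n) :
    (numFilters α β n : ℝ) ≤ 2 * (n : ℝ) ^ (rho α β / (1 - α ^ 2)) := by
  have hn' : (1 : ℝ) ≤ n := Nat.one_le_cast.2 hn
  have hR := hn'.trans (le_rpow_rho_div hβ hβα hα hn)
  rw [numFilters, ← rho_div_one_sub_sq hβ hβα hα]
  linarith [Nat.ceil_lt_add_one (zero_le_one.trans hR)]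

theorem mul_log_le_log_numFilters (hn : 1 ≤ n) :
    rho α β / (1 - α ^ 2) * Real.log n ≤ Real.log (numFilters α β n) := by
  have hn' : (0 : ℝ) < n := Nat.cast_pos.2 hn
  rw [← Real.log_rpow hn']
  exact Real.log_le_log (by positivity) (rpow_le_numFilters hβ hβα hα)

theorem log_le_log_numFilters (hn : 1 ≤ n) : Real.log n ≤ Real.log (numFilters α β n) :=
  Real.log_le_log (Nat.cast_pos.2 hn) (Nat.cast_le.2 (le_numFilters hβ hβα hα hn))

theorem mul_log_numFilters_le (hn : 1 ≤ n) :
    (1 - α ^ 2) * Real.log (numFilters α β n) ≤ rho α β * Real.log n + Real.log 2 := by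
  have hn' : (0 : ℝ) < n := Nat.cast_pos.2 hn
  have hα2 := one_sub_sq_pos (hβ.trans hβα) hα
  have hm : (0 : ℝ) < numFilters α β n := Nat.cast_pos.2 (hn.trans (le_numFilters hβ hβα hα hn))
  have hlogm : Real.log (numFilters α β n) ≤
      Real.log 2 + rho α β / (1 - α ^ 2) * Real.log n := by
    rw [← Real.log_rpow hn', ← Real.log_mul two_ne_zero (by positivity)]
    exact Real.log_le_log hm (numFilters_le hβ hβα hα hn)
  calc (1 - α ^ 2) * Real.log (numFilters α β n)
      ≤ (1 - α ^ 2) * (Real.log 2 + rho α β / (1 - α ^ 2) * Real.log n) := by gcongr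
    _ = rho α β * Real.log n + (1 - α ^ 2) * Real.log 2 := by field_simp; ring
    _ ≤ rho α β * Real.log n + 1 * Real.log 2 := by
        gcongr
        linarith [sq_nonneg α]
    _ = rho α β * Real.log n + Real.log 2 := by rw [one_mul]

theorem sq_sub_div_one_sub_sq_le {s : ℝ} (hs : 0 ≤ s) (hsβ : s ≤ β) :
    (α - β) ^ 2 / (1 - β ^ 2) ≤ (α - s) ^ 2 / (1 - s ^ 2) := by
  have hαs := one_sub_mul_pos hs (hsβ.trans hβα) hα
  have hαβ := one_sub_mul_pos hβ hβα hα
  rw [div_le_div_iff₀ (one_sub_sq_pos hβ (hβα.trans_lt hα))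
    (one_sub_sq_pos hs (hsβ.trans_lt (hβα.trans_lt hα))), ← sub_nonneg]
  calc 0 ≤ (β - s) * ((α - β) * (1 - α * s) + (α - s) * (1 - α * β)) :=
        mul_nonneg (sub_nonneg.2 hsβ) (add_nonneg (mul_nonneg (sub_nonneg.2 hβα) hαs.le)
          (mul_nonneg (sub_nonneg.2 (hsβ.trans hβα)) hαβ.le))
    _ = (α - s) ^ 2 * (1 - β ^ 2) - (α - β) ^ 2 * (1 - s ^ 2) := by ring

end Parameters

/-! ### Cost in terms of the exponents -/

theorem UnitSphere.one_le_dim {d : ℕ} (x : UnitSphere d) : 1 ≤ d := by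
  rcases Nat.eq_zero_or_pos d with rfl | hd
  · simpa using dotProduct_self_coords x
  · exact hd

section CostRpow

variable {α β : ℝ} {n d : ℕ} (hβ : 0 ≤ β) (hβα : β ≤ α) (hα : α < 1) (hn : 1 ≤ n)
  (S : Fin n → UnitSphere d) (ω : ℕ × ℕ → ℝ)
include hβ hβα hα hn

theorem build_steps_le_rpow :
    ((build α β S ω).steps : ℝ) ≤ 100 * (d * (n : ℝ) ^ (1 + rho α β / (1 - α ^ 2))) := by
  have hd : 1 ≤ d := UnitSphere.one_le_dim (S ⟨0, hn⟩)
  have hm : 1 ≤ numFilters α β n := hn.trans (le_numFilters hβ hβα hα hn)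
  have hmR := numFilters_le hβ hβα hα hn
  have hsteps : (build α β S ω).steps ≤ 50 * (d * (n * numFilters α β n)) := by
    refine (construct_steps_le α β _ ω).trans ?_
    obtain ⟨d, rfl⟩ := Nat.exists_eq_add_of_le hd
    obtain ⟨n, rfl⟩ := Nat.exists_eq_add_of_le hn
    obtain ⟨m, hm⟩ := Nat.exists_eq_add_of_le hm
    rw [hm]
    linarith [Nat.zero_le (m * d), Nat.zero_le (m * n), Nat.zero_le (d * n),
      Nat.zero_le (m * d * n)]
  rw [Real.rpow_add (Nat.cast_pos.2 hn), Real.rpow_one]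
  calc ((build α β S ω).steps : ℝ) ≤ 50 * (d * (n * numFilters α β n)) := mod_cast hsteps
    _ ≤ 50 * (d * (n * (2 * (n : ℝ) ^ (rho α β / (1 - α ^ 2))))) := by gcongr
    _ = _ := by ring

theorem space_build_le_rpow :
    ((build α β S ω).val.space : ℝ) ≤ 100 * (d * (n : ℝ) ^ (rho α β / (1 - α ^ 2))) := by
  have hd : (1 : ℝ) ≤ d := Nat.one_le_cast.2 (UnitSphere.one_le_dim (S ⟨0, hn⟩))
  have hnR := le_rpow_rho_div hβ hβα hα hn
  have hmR := numFilters_le hβ hβα hα hn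
  have hspace : (build α β S ω).val.space ≤
      numFilters α β n * d + n * d + (numFilters α β n + 2 * n) + 2 := by
    rw [DataStructure.space, Finset.sum_add_distrib, ← Finset.mul_sum, ← build_m α β S ω]
    simp only [Finset.sum_const, Finset.card_univ, Fintype.card_fin, smul_eq_mul, mul_one]
    linarith [sum_length_bucket_le α β S ω]
  have hn' : (1 : ℝ) ≤ n := Nat.one_le_cast.2 hn
  set R := (n : ℝ) ^ (rho α β / (1 - α ^ 2))
  calc ((build α β S ω).val.space : ℝ)
      ≤ numFilters α β n * d + n * d + (numFilters α β n + 2 * n) + 2 := mod_cast hspace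
    _ ≤ 2 * R * d + R * d + (2 * R + 2 * R) + 2 * R := by gcongr; linarith
    _ = 3 * (d * R) + 6 * R := by ring
    _ ≤ 100 * (d * R) := by linarith [le_mul_of_one_le_left (by linarith) hd]

theorem query_steps_le_rpow (q : UnitSphere d) :
    ((query (build α β S ω).val β (coords q)).steps : ℝ) ≤
      100 * (d * (n : ℝ) ^ (rho α β / (1 - α ^ 2))) := by
  have hd : (1 : ℝ) ≤ d := Nat.one_le_cast.2 (UnitSphere.one_le_dim q)
  have hnR := le_rpow_rho_div hβ hβα hα hn
  have hmR := numFilters_le hβ hβα hα hn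
  have hsteps : (query (build α β S ω).val β (coords q)).steps ≤
      numFilters α β n * (5 * d + 6) + n * (5 * d + 3) := by
    refine (query_steps_le _ β _).trans ?_
    rw [← build_m α β S ω]
    gcongr
    exact sum_length_bucket_le α β S ω
  set R := (n : ℝ) ^ (rho α β / (1 - α ^ 2))
  have hR : 0 ≤ R := by positivity
  calc ((query (build α β S ω).val β (coords q)).steps : ℝ)
      ≤ numFilters α β n * (5 * d + 6) + n * (5 * d + 3) := mod_cast hsteps
    _ ≤ 2 * R * (5 * d + 6) + R * (5 * d + 3) := by gcongr
    _ = 15 * (d * R) + 15 * R := by ring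
    _ ≤ 100 * (d * R) := by linarith [le_mul_of_one_le_left hR hd]

end CostRpow

/-! ### Expected numbers of inspected buckets and of far points -/

theorem sq_sub_two_mul_le_posPart_sq {u v : ℝ} (hu : 0 ≤ u) (hv : 0 ≤ v) :
    u ^ 2 - 2 * (u * v) ≤ (u - v)⁺ ^ 2 := by
  rcases le_total (u - v) 0 with h | h
  · rw [posPart_eq_zero.2 h]
    nlinarith
  · rw [posPart_eq_self.2 h]
    nlinarith

/-- The term `√(2 log m) √(2 (1 - α²) log log m)` that appears when the square of `η` is expanded;
its exponential is the factor `n ^ o(1)` of the bounds. -/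
noncomputable def crossTerm (α : ℝ) (m : ℕ) : ℝ :=
  √(2 * Real.log m) * √(2 * (1 - α ^ 2) * Real.log (Real.log m))

theorem crossTerm_nonneg (α : ℝ) (m : ℕ) : 0 ≤ crossTerm α m := by
  unfold crossTerm
  positivity

theorem neg_posPart_sq_div_le {α s : ℝ} {m : ℕ} (hs : 0 ≤ s) (hsα : s ≤ α) (hα : α < 1) :
    -(eta α m - s * √(2 * Real.log m))⁺ ^ 2 / (2 * (1 - s ^ 2)) ≤
      -((α - s) ^ 2 / (1 - s ^ 2) * Real.log m) + crossTerm α m := by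
  have hs2 : 0 < 1 - s ^ 2 := one_sub_sq_pos hs (hsα.trans_lt hα)
  have ha : √(2 * Real.log m) ^ 2 = 2 * Real.log m :=
    Real.sq_sqrt (mul_nonneg zero_le_two (Real.log_natCast_nonneg m))
  have hexpand := sq_sub_two_mul_le_posPart_sq (v := √(2 * (1 - α ^ 2) * Real.log (Real.log m)))
    (mul_nonneg (sub_nonneg.2 hsα) (Real.sqrt_nonneg (2 * Real.log m))) (Real.sqrt_nonneg _)
  have hcross : (α - s) * crossTerm α m ≤ (1 - s ^ 2) * crossTerm α m :=
    mul_le_mul_of_nonneg_right (by nlinarith) (crossTerm_nonneg α m)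
  have heta : eta α m - s * √(2 * Real.log m) =
      (α - s) * √(2 * Real.log m) - √(2 * (1 - α ^ 2) * Real.log (Real.log m)) := by
    rw [eta]
    ring
  rw [mul_pow, ha, mul_assoc (α - s), ← crossTerm, ← heta] at hexpand
  rw [div_le_iff₀ (by positivity)]
  calc -(eta α m - s * √(2 * Real.log m))⁺ ^ 2
      ≤ -((α - s) ^ 2 * (2 * Real.log m)) + 2 * ((1 - s ^ 2) * crossTerm α m) := by linarith
    _ = _ := by field_simp

theorem eta_le_sqrt {α : ℝ} (hα : α ≤ 1) (m : ℕ) : eta α m ≤ √(2 * Real.log m) :=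
  (sub_le_self _ (Real.sqrt_nonneg _)).trans (mul_le_of_le_one_left (Real.sqrt_nonneg _) hα)

theorem natCast_mul_exp_neg_sq_sqrt {m : ℕ} (hm : 0 < m) :
    m * Real.exp (-√(2 * Real.log m) ^ 2 / 2) = 1 := by
  rw [Real.sq_sqrt (mul_nonneg zero_le_two (Real.log_natCast_nonneg m)), neg_div,
    mul_div_cancel_left₀ _ two_ne_zero, Real.exp_neg, Real.exp_log (Nat.cast_pos.2 hm),
    mul_inv_cancel₀ (Nat.cast_ne_zero.2 hm.ne')]

section Bounds

variable {α β : ℝ} {n d : ℕ} (hβ : 0 ≤ β) (hβα : β ≤ α) (hα : α < 1) (hn : 1 ≤ n)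
  (S : Fin n → UnitSphere d) (q : UnitSphere d)
include hβ hβα hα hn

theorem exp_neg_posPart_sq_div_le_rpow {s : ℝ} (hs : 0 ≤ s) (hsβ : s ≤ β) :
    Real.exp (-(eta α (numFilters α β n) - s * √(2 * Real.log (numFilters α β n)))⁺ ^ 2 /
        (2 * (1 - s ^ 2))) ≤
      (n : ℝ) ^ (rho α β - 1) * Real.exp (crossTerm α (numFilters α β n)) := by
  have hβ2 := one_sub_sq_pos hβ (hβα.trans_lt hα)
  have hrate : (1 - rho α β) * Real.log n ≤
      (α - s) ^ 2 / (1 - s ^ 2) * Real.log (numFilters α β n) :=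
    calc (1 - rho α β) * Real.log n
        = (α - β) ^ 2 / (1 - β ^ 2) * (rho α β / (1 - α ^ 2) * Real.log n) := by
          rw [one_sub_rho hβ hβα hα, mul_assoc]
      _ ≤ (α - s) ^ 2 / (1 - s ^ 2) * Real.log (numFilters α β n) :=
          mul_le_mul (sq_sub_div_one_sub_sq_le hβ hβα hα hs hsβ)
            (mul_log_le_log_numFilters hβ hβα hα hn)
            (mul_nonneg (zero_le_one.trans (one_le_rho_div hβ hβα hα))
              (Real.log_natCast_nonneg n))
            ((by positivity : 0 ≤ (α - β) ^ 2 / (1 - β ^ 2)).trans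
              (sq_sub_div_one_sub_sq_le hβ hβα hα hs hsβ))
  rw [Real.rpow_def_of_pos (Nat.cast_pos.2 hn), ← Real.exp_add, Real.exp_le_exp]
  linarith [neg_posPart_sq_div_le (m := numFilters α β n) hs (hsβ.trans hβα) hα]

theorem lintegral_numInspected_le_rpow :
    ∫⁻ ω, (numInspected α β S q ω : ENNReal) ∂gaussianSource ≤
      ENNReal.ofReal (2 * (n : ℝ) ^ rho α β * Real.exp (crossTerm α (numFilters α β n))) := by
  refine lintegral_numInspected_le.trans (ENNReal.ofReal_le_ofReal ?_)
  have hm : (0 : ℝ) < numFilters α β n := Nat.cast_pos.2 (hn.trans (le_numFilters hβ hβα hα hn))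
  have hexp := neg_posPart_sq_div_le (m := numFilters α β n) le_rfl (hβ.trans hβα) hα
  simp only [zero_mul, sub_zero, ne_eq, OfNat.ofNat_ne_zero, not_false_eq_true, zero_pow,
    mul_one, div_one] at hexp
  calc numFilters α β n * Real.exp (-(eta α (numFilters α β n))⁺ ^ 2 / 2)
      = Real.exp (Real.log (numFilters α β n) + -(eta α (numFilters α β n))⁺ ^ 2 / 2) := by
        rw [Real.exp_add, Real.exp_log hm]
    _ ≤ Real.exp (Real.log 2 + Real.log n * rho α β + crossTerm α (numFilters α β n)) := by
        rw [Real.exp_le_exp]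
        linarith [mul_log_numFilters_le hβ hβα hα hn]
    _ = _ := by
        rw [Real.exp_add, Real.exp_add, Real.exp_log two_pos,
          Real.rpow_def_of_pos (Nat.cast_pos.2 hn)]

theorem two_inv_pow_numFilters_le :
    (2⁻¹ : ℝ) ^ numFilters α β n ≤
      (n : ℝ) ^ (rho α β - 1) * Real.exp (crossTerm α (numFilters α β n)) := by
  have hn' : (1 : ℝ) ≤ n := Nat.one_le_cast.2 hn
  calc (2⁻¹ : ℝ) ^ numFilters α β n ≤ 2⁻¹ ^ n :=
        pow_le_pow_of_le_one (by norm_num) (by norm_num) (le_numFilters hβ hβα hα hn)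
    _ ≤ (n : ℝ)⁻¹ := by
        rw [inv_pow]
        gcongr
        exact_mod_cast Nat.lt_two_pow_self.le
    _ = (n : ℝ) ^ (-1 : ℝ) := (Real.rpow_neg_one _).symm
    _ ≤ (n : ℝ) ^ (rho α β - 1) :=
        Real.rpow_le_rpow_of_exponent_le hn' (by linarith [rho_nonneg hβ hβα hα])
    _ ≤ _ := le_mul_of_one_le_right (by positivity) (Real.one_le_exp (crossTerm_nonneg _ _))

theorem measure_inspected_le_rpow {k : Fin n} (hk : sim q (S k) < β) :
    gaussianSource {ω | Inspected α β S q ω k} ≤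
      ENNReal.ofReal
        (2 * ((n : ℝ) ^ (rho α β - 1) * Real.exp (crossTerm α (numFilters α β n)))) := by
  have hx := dotProduct_self_coords (S k)
  have hq := dotProduct_self_coords q
  have hs : coords (S k) ⬝ᵥ coords q = sim q (S k) := by
    rw [sim_eq_dotProduct, dotProduct_comm]
  simp only [inspected_iff, Set.ofPred_mem_eq]
  rcases le_total (sim q (S k)) 0 with hs0 | hs0
  · refine (measure_collision_le_of_nonpos hx hq hs hs0 _).trans ?_
    rw [two_mul, ENNReal.ofReal_add (by positivity) (by positivity)]
    gcongr
    · rw [← ENNReal.ofReal_ofNat, ← ENNReal.ofReal_inv_of_pos two_pos,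
        ← ENNReal.ofReal_pow (by norm_num)]
      exact ENNReal.ofReal_le_ofReal (two_inv_pow_numFilters_le hβ hβα hα hn)
    · simpa using exp_neg_posPart_sq_div_le_rpow hβ hβα hα hn le_rfl hβ
  · refine (measure_collision_le hx hq hs hs0 (by linarith) (Real.sqrt_nonneg _)
      (eta_le_sqrt hα.le _)).trans (ENNReal.ofReal_le_ofReal ?_)
    rw [natCast_mul_exp_neg_sq_sqrt (hn.trans (le_numFilters hβ hβα hα hn)), one_add_one_eq_two]
    gcongr
    exact exp_neg_posPart_sq_div_le_rpow hβ hβα hα hn hs0 hk.le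

theorem lintegral_numFar_le_rpow :
    ∫⁻ ω, (numFar α β S q ω : ENNReal) ∂gaussianSource ≤
      ENNReal.ofReal (2 * (n : ℝ) ^ rho α β * Real.exp (crossTerm α (numFilters α β n))) := by
  refine (lintegral_numFar_le fun k =>
    measure_inspected_le_rpow hβ hβα hα hn S q (k := k)).trans_eq ?_
  have hn' : (0 : ℝ) < n := Nat.cast_pos.2 hn
  rw [← ENNReal.ofReal_natCast, ← ENNReal.ofReal_mul hn'.le, Real.rpow_sub_one hn'.ne']
  congr 1
  field_simp

end Bounds

/-! ### The probability of missing a close point -/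

theorem gaussianReal_Iio_pow_le {t δ : ℝ} (ht : 0 ≤ t) (hδ : 0 ≤ δ) (m : ℕ) :
    gaussianReal 0 1 (Set.Iio t) ^ m ≤
      ENNReal.ofReal (Real.exp (-(m * (δ * gaussianPDFReal 0 1 (t + δ))))) := by
  have htail := mul_gaussianPDFReal_le_Ici one_ne_zero ht hδ
  have hIio : (gaussianReal 0 1).real (Set.Iio t) = 1 - (gaussianReal 0 1).real (Set.Ici t) := by
    rw [← Set.compl_Ici, probReal_compl_eq_one_sub measurableSet_Ici]
  rw [← ofReal_measureReal, ← ENNReal.ofReal_pow measureReal_nonneg, ← mul_neg, Real.exp_nat_mul]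
  gcongr
  rw [hIio]
  linarith [Real.add_one_le_exp (-(δ * gaussianPDFReal 0 1 (t + δ)))]

theorem sqrt_sub_sqrt_le {x y : ℝ} (hx : 0 < x) (hy : 0 ≤ y) (hyx : y ≤ x) :
    √x - √y ≤ (x - y) / √x := by
  rw [le_div_iff₀ (Real.sqrt_pos.2 hx)]
  calc (√x - √y) * √x ≤ (√x - √y) * (√x + √y) :=
        mul_le_mul_of_nonneg_left (le_add_of_nonneg_right (Real.sqrt_nonneg y))
          (sub_nonneg.2 (Real.sqrt_le_sqrt hyx))
    _ = x - y := by rw [mul_comm, ← sq_sub_sq, Real.sq_sqrt hx.le, Real.sq_sqrt hy]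

theorem sqrt_sub_three_mul_div_le {L l : ℝ} (hL : 0 < L) (hl : 0 ≤ l) (hlL : l ≤ L) :
    √(2 * L) - 3 * l / √(2 * L) ≤ √(2 * (L - l)) - l / √(2 * L) := by
  have hgap := sqrt_sub_sqrt_le (x := 2 * L) (y := 2 * (L - l)) (by linarith) (by linarith)
    (by linarith)
  rw [show 2 * L - 2 * (L - l) = 2 * l by ring] at hgap
  linarith [show 3 * l / √(2 * L) = 2 * l / √(2 * L) + l / √(2 * L) by ring]

/-- A level that the largest of `m` independent standard normal variables exceeds with high
probability: `δ = log log m / √(2 log m)` below the point `√(2 (log m - log log m))`, at which the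
Gaussian density times `m` has order `log m`. -/
noncomputable def maxLevel (m : ℕ) : ℝ :=
  √(2 * (Real.log m - Real.log (Real.log m))) - Real.log (Real.log m) / √(2 * Real.log m)

section Miss

variable {m : ℕ} (hL : 1 ≤ Real.log m)
include hL

theorem maxLevel_nonneg (hlL : 3 * Real.log (Real.log m) ≤ 2 * Real.log m) : 0 ≤ maxLevel m := by
  have hl : 0 ≤ Real.log (Real.log m) := Real.log_nonneg hL
  refine le_trans ?_ (sqrt_sub_three_mul_div_le (by linarith) hl (by linarith))
  rw [sub_nonneg, div_le_iff₀ (Real.sqrt_pos.2 (by linarith)), Real.mul_self_sqrt (by linarith)]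
  exact hlL

theorem log_log_div_four_le :
    Real.log (Real.log m) / 4 ≤ m * (Real.log (Real.log m) / √(2 * Real.log m) *
      gaussianPDFReal 0 1 (√(2 * (Real.log m - Real.log (Real.log m))))) := by
  have hL0 : 0 < Real.log m := by linarith
  have hm : (0 : ℝ) < m := Nat.cast_pos.2 (Nat.pos_of_ne_zero (by rintro rfl; simp at hL0))
  have hl : 0 ≤ Real.log (Real.log m) := Real.log_nonneg hL
  have hlL : Real.log (Real.log m) ≤ Real.log m :=
    (Real.log_le_sub_one_of_pos hL0).trans (by linarith)
  have hpdf : m * gaussianPDFReal 0 1 (√(2 * (Real.log m - Real.log (Real.log m)))) =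
      (√(2 * Real.pi))⁻¹ * Real.log m := by
    rw [gaussianPDFReal, sub_zero, Real.sq_sqrt (by linarith), NNReal.coe_one, mul_one, mul_one,
      neg_div, mul_div_cancel_left₀ _ two_ne_zero, neg_sub, Real.exp_sub, Real.exp_log hL0,
      Real.exp_log hm]
    field_simp
  have hA : √(2 * Real.log m) ^ 2 = 2 * Real.log m := Real.sq_sqrt (by linarith)
  have hπ : √(2 * Real.pi) ≤ 2 * √(2 * Real.log m) := by
    refine Real.sqrt_le_iff.2 ⟨by positivity, ?_⟩
    rw [mul_pow, hA]
    linarith [Real.pi_le_four]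
  have : 0 < √(2 * Real.log m) := Real.sqrt_pos.2 (by linarith)
  calc Real.log (Real.log m) / 4
      ≤ Real.log (Real.log m) / 4 * (2 * √(2 * Real.log m) / √(2 * Real.pi)) :=
        le_mul_of_one_le_right (by positivity) ((one_le_div (by positivity)).2 hπ)
    _ = Real.log (Real.log m) / √(2 * Real.log m) * ((√(2 * Real.pi))⁻¹ * Real.log m) := by
        field_simp
        rw [hA]
        ring
    _ = _ := by rw [← hpdf]; ring

variable {α : ℝ} (hα0 : 0 ≤ α) (hα : α < 1)
  (hlL : 100 * Real.log (Real.log m) ≤ (1 - α ^ 2) * Real.log m)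
include hα0 hα hlL

theorem log_log_div_two_le :
    Real.log (Real.log m) / 2 ≤
      (α * maxLevel m - eta α m)⁺ ^ 2 / (2 * (1 - α ^ 2)) := by
  have : 0 < 1 - α ^ 2 := one_sub_sq_pos hα0 hα
  rw [eta, maxLevel]
  set L := Real.log m
  have hl : 0 ≤ Real.log L := Real.log_nonneg hL
  set l := Real.log L
  have hA0 : 0 < √(2 * L) := Real.sqrt_pos.2 (by linarith)
  set v := √(2 * (1 - α ^ 2) * l) with hv
  have hv2 : v ^ 2 = 2 * (1 - α ^ 2) * l := Real.sq_sqrt (by positivity)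
  have hvA : 20 * l ≤ v * √(2 * L) := by
    rw [hv, ← Real.sqrt_mul (by positivity)]
    refine Real.le_sqrt_of_sq_le ?_
    nlinarith
  have hshift : 3 * l / √(2 * L) ≤ 3 / 20 * v := by
    rw [div_le_iff₀ hA0]
    linarith
  have hlow := sqrt_sub_three_mul_div_le (L := L) (l := l) (by linarith) hl (by nlinarith)
  have hmargin : 17 / 20 * v ≤ α * (√(2 * (L - l)) - l / √(2 * L)) - (α * √(2 * L) - v) := by
    nlinarith [mul_le_mul_of_nonneg_left hlow hα0, Real.sqrt_nonneg (2 * (1 - α ^ 2) * l)]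
  have hsq : (17 / 20 * v) ^ 2 ≤
      (α * (√(2 * (L - l)) - l / √(2 * L)) - (α * √(2 * L) - v))⁺ ^ 2 := by
    gcongr
    exact hmargin.trans (le_posPart _)
  rw [le_div_iff₀ (by positivity)]
  nlinarith

end Miss

theorem measure_not_inspected_le {α β : ℝ} {n d : ℕ} (hα0 : 0 ≤ α) (hα : α < 1)
    (hL : 1 ≤ Real.log (numFilters α β n))
    (hlL : 100 * Real.log (Real.log (numFilters α β n)) ≤
      (1 - α ^ 2) * Real.log (numFilters α β n))
    {S : Fin n → UnitSphere d} {q : UnitSphere d} {k : Fin n} (hk : α ≤ sim q (S k)) :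
    gaussianSource {ω | ¬ Inspected α β S q ω k} ≤
      ENNReal.ofReal (2 * Real.exp (-(Real.log (Real.log (numFilters α β n)) / 4))) := by
  have hs : coords (S k) ⬝ᵥ coords q = sim q (S k) := by
    rw [sim_eq_dotProduct, dotProduct_comm]
  simp only [inspected_iff]
  set m := numFilters α β n
  have hm : 0 < m := Nat.pos_of_ne_zero fun h => by simp [h] at hL; linarith
  have hl : 0 ≤ Real.log (Real.log m) := Real.log_nonneg hL
  have : 0 < 1 - α ^ 2 := one_sub_sq_pos hα0 hα
  have ht := maxLevel_nonneg hL (by nlinarith)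
  refine (measure_compl_collision_le (dotProduct_self_coords _) (dotProduct_self_coords _) hs hm
    hα0 hk ht).trans ?_
  rw [two_mul (Real.exp _), ENNReal.ofReal_add (by positivity) (by positivity)]
  gcongr
  · refine (gaussianReal_Iio_pow_le ht (δ := Real.log (Real.log m) / √(2 * Real.log m))
      (div_nonneg hl (Real.sqrt_nonneg _)) m).trans
      (ENNReal.ofReal_le_ofReal (Real.exp_le_exp.2 (neg_le_neg ?_)))
    rw [maxLevel, sub_add_cancel]
    exact log_log_div_four_le hL
  · rw [neg_div]
    exact neg_le_neg ((by linarith : _ ≤ _).trans (log_log_div_two_le hL hα0 hα hlL))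

/-! ### Asymptotics -/

/-- The `o(1)` term of all the bounds: the first summand is the excess over `ρ` of the exponents of
the expected numbers of buckets and far points, the second one bounds the probability of missing a
close point. -/
noncomputable def rate (α β : ℝ) (n : ℕ) : ℝ :=
  (Real.log 2 + crossTerm α (numFilters α β n)) / Real.log n +
    2 * Real.exp (-(Real.log (Real.log (numFilters α β n)) / 4))

theorem two_mul_exp_le_rate (α β : ℝ) (n : ℕ) :
    2 * Real.exp (-(Real.log (Real.log (numFilters α β n)) / 4)) ≤ rate α β n :=
  le_add_of_nonneg_left (div_nonneg (add_nonneg (Real.log_nonneg one_le_two) (crossTerm_nonneg _ _))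
    (Real.log_natCast_nonneg n))

theorem two_mul_rpow_mul_exp_le_rpow_rate {α β : ℝ} {n : ℕ} (hn : 1 < n) :
    2 * (n : ℝ) ^ rho α β * Real.exp (crossTerm α (numFilters α β n)) ≤
      (n : ℝ) ^ (rho α β + rate α β n) := by
  have hn' : (1 : ℝ) < n := Nat.one_lt_cast.2 hn
  calc 2 * (n : ℝ) ^ rho α β * Real.exp (crossTerm α (numFilters α β n))
      = (n : ℝ) ^ rho α β * Real.exp (Real.log 2 + crossTerm α (numFilters α β n)) := by
        rw [Real.exp_add, Real.exp_log two_pos]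
        ring
    _ = (n : ℝ) ^ (rho α β +
          (Real.log 2 + crossTerm α (numFilters α β n)) / Real.log n) := by
        rw [Real.rpow_add (by positivity), Real.rpow_def_of_pos (by positivity) (_ / _),
          mul_div_cancel₀ _ (Real.log_pos hn').ne']
    _ ≤ (n : ℝ) ^ (rho α β + rate α β n) := by
        refine Real.rpow_le_rpow_of_exponent_le hn'.le (add_le_add_right ?_ _)
        exact le_add_of_nonneg_right (by positivity)

theorem crossTerm_le {α β : ℝ} {n : ℕ} (hβ : 0 ≤ β) (hβα : β ≤ α) (hα : α < 1) (hn : 2 ≤ n)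
    (hL : 1 ≤ Real.log (numFilters α β n)) :
    crossTerm α (numFilters α β n) ≤ 4 * √(Real.log (Real.log (numFilters α β n)) /
      Real.log (numFilters α β n) / (1 - α ^ 2)) * Real.log n := by
  have hα2 := one_sub_sq_pos (hβ.trans hβα) hα
  have hlogn : Real.log 2 ≤ Real.log n := Real.log_le_log two_pos (Nat.ofNat_le_cast.2 hn)
  have hlogm := mul_log_numFilters_le hβ hβα hα (one_le_two.trans hn)
  have hρ : rho α β * Real.log n ≤ 1 * Real.log n :=
    mul_le_mul_of_nonneg_right (rho_le_one hβ hβα hα) (Real.log_natCast_nonneg n)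
  rw [crossTerm]
  set L := Real.log (numFilters α β n)
  set l := Real.log L
  have : 0 ≤ l := Real.log_nonneg hL
  calc √(2 * L) * √(2 * (1 - α ^ 2) * l)
      = √((2 * ((1 - α ^ 2) * L)) ^ 2 * (l / L / (1 - α ^ 2))) := by
        rw [← Real.sqrt_mul (by linarith)]
        congr 1
        field_simp
    _ = 2 * ((1 - α ^ 2) * L) * √(l / L / (1 - α ^ 2)) := by
        rw [Real.sqrt_mul (by positivity), Real.sqrt_sq (by positivity)]
    _ ≤ 2 * (2 * Real.log n) * √(l / L / (1 - α ^ 2)) := by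
        gcongr 2 * ?_ * _
        linarith
    _ = 4 * √(l / L / (1 - α ^ 2)) * Real.log n := by ring

theorem tendsto_log_natCast : Tendsto (fun n : ℕ => Real.log n) atTop atTop :=
  Real.tendsto_log_atTop.comp tendsto_natCast_atTop_atTop

section Asymptotics

variable {α β : ℕ → ℝ} (h : ∀ n, 0 ≤ β n ∧ β n ≤ α n ∧ α n < 1)
include h

theorem tendsto_log_numFilters :
    Tendsto (fun n => Real.log (numFilters (α n) (β n) n)) atTop atTop := by
  refine tendsto_atTop_mono' _ ?_ tendsto_log_natCast
  filter_upwards [eventually_ge_atTop 1] with n hn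
  exact log_le_log_numFilters (h n).1 (h n).2.1 (h n).2.2 hn

variable (hlog : (fun n : ℕ => Real.log (Real.log (numFilters (α n) (β n) n)) /
  Real.log (numFilters (α n) (β n) n)) =o[atTop] fun n => 1 - α n ^ 2)
include hlog

theorem eventually_mul_log_log_numFilters_le :
    ∀ᶠ n in atTop, 100 * Real.log (Real.log (numFilters (α n) (β n) n)) ≤
      (1 - α n ^ 2) * Real.log (numFilters (α n) (β n) n) := by
  filter_upwards [hlog.bound (show (0 : ℝ) < 1 / 100 by norm_num),
    (tendsto_log_numFilters h).eventually_gt_atTop 0] with n hbound hL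
  obtain ⟨hβ, hβα, hα⟩ := h n
  rw [Real.norm_of_nonneg (one_sub_sq_pos (hβ.trans hβα) hα).le] at hbound
  have hle := (le_abs_self _).trans hbound
  rw [div_le_iff₀ hL] at hle
  linarith

theorem tendsto_crossTerm_div_log :
    Tendsto (fun n : ℕ => crossTerm (α n) (numFilters (α n) (β n) n) / Real.log n) atTop
      (𝓝 0) := by
  have hquot : Tendsto (fun n : ℕ => 4 * √(Real.log (Real.log (numFilters (α n) (β n) n)) /
      Real.log (numFilters (α n) (β n) n) / (1 - α n ^ 2))) atTop (𝓝 0) := by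
    simpa using hlog.tendsto_div_nhds_zero.sqrt.const_mul 4
  refine squeeze_zero' (Eventually.of_forall fun n =>
    div_nonneg (crossTerm_nonneg _ _) (Real.log_natCast_nonneg n)) ?_ hquot
  filter_upwards [eventually_ge_atTop 2, (tendsto_log_numFilters h).eventually_ge_atTop 1]
    with n hn hL
  obtain ⟨hβ, hβα, hα⟩ := h n
  rw [div_le_iff₀ (Real.log_pos (Nat.one_lt_cast.2 hn))]
  exact crossTerm_le hβ hβα hα hn hL

theorem tendsto_rate : Tendsto (fun n => rate (α n) (β n) n) atTop (𝓝 0) := by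
  have htwo : Tendsto (fun n : ℕ => Real.log 2 / Real.log n) atTop (𝓝 0) :=
    tendsto_log_natCast.const_div_atTop _
  have hmiss : Tendsto (fun n => 2 * Real.exp
      (-(Real.log (Real.log (numFilters (α n) (β n) n)) / 4))) atTop (𝓝 (2 * 0)) :=
    (Real.tendsto_exp_neg_atTop_nhds_zero.comp ((Real.tendsto_log_atTop.comp
      (tendsto_log_numFilters h)).atTop_div_const four_pos)).const_mul 2
  simpa [rate, add_div] using (htwo.add (tendsto_crossTerm_div_log h hlog)).add hmiss

end Asymptotics

end Top1

theorem mainTheorem3_general :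
    ∃ C : ℝ, 0 < C ∧ ∀ α β : ℕ → ℝ,
      (∀ n, 0 ≤ β n ∧ β n ≤ α n ∧ α n < 1) →
      ((fun n : ℕ => Real.log (Real.log (Top1.numFilters (α n) (β n) n)) /
          Real.log (Top1.numFilters (α n) (β n) n))
        =o[atTop] fun n => 1 - α n ^ 2) →
      (∀ n : ℕ, 1 ≤ n → ∀ (d : ℕ) (S : Fin n → Top1.UnitSphere d) (ω : ℕ × ℕ → ℝ),
        ((Top1.build (α n) (β n) S ω).steps : ℝ) ≤
            C * (d * (n : ℝ) ^ (1 + Top1.rho (α n) (β n) / (1 - α n ^ 2))) ∧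
        ((Top1.build (α n) (β n) S ω).val.space : ℝ) ≤
            C * (d * (n : ℝ) ^ (Top1.rho (α n) (β n) / (1 - α n ^ 2))) ∧
        ∀ q : Top1.UnitSphere d,
          ((Top1.query (Top1.build (α n) (β n) S ω).val (β n) (Top1.coords q)).steps : ℝ) ≤
            C * (d * (n : ℝ) ^ (Top1.rho (α n) (β n) / (1 - α n ^ 2)))) ∧
      ∃ ε : ℕ → ℝ, Tendsto ε atTop (𝓝 0) ∧
        ∀ᶠ n : ℕ in atTop, ∀ (d : ℕ) (S : Fin n → Top1.UnitSphere d) (q : Top1.UnitSphere d),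
          ((∃ k, α n ≤ Top1.sim q (S k)) →
            Top1.gaussianSource {ω | ¬ Top1.Succeeds (α n) (β n) S q ω} ≤
              ENNReal.ofReal (ε n)) ∧
          (∫⁻ ω, (Top1.numInspected (α n) (β n) S q ω : ENNReal) ∂Top1.gaussianSource ≤
            ENNReal.ofReal ((n : ℝ) ^ (Top1.rho (α n) (β n) + ε n))) ∧
          (∫⁻ ω, (Top1.numFar (α n) (β n) S q ω : ENNReal) ∂Top1.gaussianSource ≤
            ENNReal.ofReal ((n : ℝ) ^ (Top1.rho (α n) (β n) + ε n))) ∧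
          (∀ k, α n ≤ Top1.sim q (S k) →
            Top1.gaussianSource {ω | ¬ Top1.Inspected (α n) (β n) S q ω k} ≤
              ENNReal.ofReal (ε n)) := by
  refine ⟨100, by norm_num, fun α β h hlog => ⟨fun n hn d S ω => ?_, ?_⟩⟩
  · obtain ⟨hβ, hβα, hα⟩ := h n
    exact ⟨Top1.build_steps_le_rpow hβ hβα hα hn S ω, Top1.space_build_le_rpow hβ hβα hα hn S ω,
      Top1.query_steps_le_rpow hβ hβα hα hn S ω⟩
  refine ⟨fun n => Top1.rate (α n) (β n) n, Top1.tendsto_rate h hlog, ?_⟩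
  filter_upwards [eventually_gt_atTop 1, (Top1.tendsto_log_numFilters h).eventually_ge_atTop 1,
    Top1.eventually_mul_log_log_numFilters_le h hlog] with n hn hL hlL d S q
  obtain ⟨hβ, hβα, hα⟩ := h n
  have hrate := ENNReal.ofReal_le_ofReal
    (Top1.two_mul_rpow_mul_exp_le_rpow_rate (α := α n) (β := β n) hn)
  have hclose (k : Fin n) (hk : α n ≤ Top1.sim q (S k)) :=
    (Top1.measure_not_inspected_le (hβ.trans hβα) hα hL hlL hk).trans
      (ENNReal.ofReal_le_ofReal (Top1.two_mul_exp_le_rate (α n) (β n) n))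
  refine ⟨?_, (Top1.lintegral_numInspected_le_rpow hβ hβα hα hn.le S q).trans hrate,
    (Top1.lintegral_numFar_le_rpow hβ hβα hα hn.le S q).trans hrate, hclose⟩
  rintro ⟨k, hk⟩
  refine (measure_mono ?_).trans (hclose k hk)
  exact fun ω hω hi => hω (hi.succeeds (hβα.trans hk))

theorem mainTheorem3 :
    ∃ C : ℝ, 0 < C ∧ ∀ α β : ℕ → ℝ,
      (∀ n, 0 < β n ∧ β n < α n ∧ α n < 1) →
      ((fun n => Top1.rho (α n) (β n)) =O[atTop] fun _ => (1 : ℝ)) →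
      ((fun n : ℕ => (1 - α n ^ 2) * Real.sqrt (Real.log (Real.log n) / Real.log n))
        =o[atTop] fun n => α n - β n) →
      ((fun n : ℕ => Real.log (Real.log (Top1.numFilters (α n) (β n) n)) /
          Real.log (Top1.numFilters (α n) (β n) n))
        =o[atTop] fun n => 1 - α n ^ 2) →
      -- preprocessing time, space and query time
      (∀ n : ℕ, 1 ≤ n → ∀ (d : ℕ) (S : Fin n → Top1.UnitSphere d) (ω : ℕ × ℕ → ℝ),
        ((Top1.build (α n) (β n) S ω).steps : ℝ) ≤
            C * (d * (n : ℝ) ^ (1 + Top1.rho (α n) (β n) / (1 - α n ^ 2))) ∧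
        ((Top1.build (α n) (β n) S ω).val.space : ℝ) ≤
            C * (d * (n : ℝ) ^ (Top1.rho (α n) (β n) / (1 - α n ^ 2))) ∧
        ∀ q : Top1.UnitSphere d,
          ((Top1.query (Top1.build (α n) (β n) S ω).val (β n) (Top1.coords q)).steps : ℝ) ≤
            C * (d * (n : ℝ) ^ (Top1.rho (α n) (β n) / (1 - α n ^ 2)))) ∧
      -- probabilities and expectations, uniformly in the dimension, the dataset and the query
      ∃ ε : ℕ → ℝ, Tendsto ε atTop (𝓝 0) ∧
        ∀ᶠ n : ℕ in atTop, ∀ (d : ℕ) (S : Fin n → Top1.UnitSphere d) (q : Top1.UnitSphere d),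
          -- the data structure solves the approximate near neighbor problem
          ((∃ k, α n ≤ Top1.sim q (S k)) →
            Top1.gaussianSource {ω | ¬ Top1.Succeeds (α n) (β n) S q ω} ≤
              ENNReal.ofReal (ε n)) ∧
          -- the expected number of inspected buckets
          (∫⁻ ω, (Top1.numInspected (α n) (β n) S q ω : ENNReal) ∂Top1.gaussianSource ≤
            ENNReal.ofReal ((n : ℝ) ^ (Top1.rho (α n) (β n) + ε n))) ∧
          -- the expected number of far points in the inspected buckets
          (∫⁻ ω, (Top1.numFar (α n) (β n) S q ω : ENNReal) ∂Top1.gaussianSource ≤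
            ENNReal.ofReal ((n : ℝ) ^ (Top1.rho (α n) (β n) + ε n))) ∧
          -- each close point is in an inspected bucket with high probability
          (∀ k, α n ≤ Top1.sim q (S k) →
            Top1.gaussianSource {ω | ¬ Top1.Inspected (α n) (β n) S q ω k} ≤
              ENNReal.ofReal (ε n)) := by
  obtain ⟨C, hC, hmain⟩ := mainTheorem3_general
  exact ⟨C, hC, fun α β h _ _ hlog =>
    hmain α β (fun n => ⟨(h n).1.le, (h n).2.1.le, (h n).2.2⟩) hlog⟩
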